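/- **Setting.** An $[n,k,\alpha]$ code over a finite field $\mathbb F_q$ is given by a linear encoding function from messages of $k$ symbols to codewords of $n$ symbols, a symbol being a vector of $\alpha$ subsymbols in $\mathbb F_q$; it is MDS if its image has dimension $\alpha k$ and minimum distance $n-k+1$, counted in symbols. Scalar means $\alpha=1$. For $\varsigma\ge 2$, an MDS $(n^I,k^I;n^F,k^F=\varsigma k^I)$ convertible code consists of an $[n^I,k^I,\alpha]$ MDS initial code, an $[n^F,k^F,\alpha]$ MDS final code and a procedure converting the $\varsigma$ initial codewords of messages $m_1,\dots,m_\varsigma$ into the final codeword of $(m_1,\dots,m_\varsigma)$: every final node is either an unchanged initial node or new; $\beta(x)\le\alpha$ subsymbols, functions of the content of the initial node $x$, are downloaded from each $x$; the new nodes are computed from all downloaded data. Its access cost is the number of nodes $x$ with $\beta(x)>0$ plus the number of new nodes, and it is access-optimal if this cost is minimum among all MDS convertible codes with the same $(n^I,k^I;n^F,k^F)$. Its conversion bandwidth is $\gamma=\sum_x\beta(x)+\alpha\cdot\#\{\text{new nodes}\}$. With $r^I=n^I-k^I$ and $r^F=n^F-k^F$, it is bandwidth-optimal if $\gamma$ equals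 $$\varsigma\alpha\min\{k^I,r^F\}+r^F\alpha\ \text{ if } r^F\le r^I \text{ or } k^I\le r^F,\qquad \varsigma\alpha\Bigl(r^I+k^I\bigl(1-\tfrac{r^I}{r^F}\bigr)\Bigr)+r^F\alpha\ \text{ otherwise,}$$ and $\gamma/\alpha$ is minimum among all MDS convertible codes with the same $(n^I,k^I;n^F,k^F)$ (over any finite field and with any symbol size). **Parameters.** Let $1\le k^I\le n^I$, $r^I=n^I-k^I$, and let $S$ be a finite set of pairs $(n^F,k^F)$ with $n^F\ge k^F=\varsigma' k^I$ for an integer $\varsigma'\ge 2$ depending on the pair. Let $r_1,\dots,r_t$ be the distinct values of $n^F-k^F$ on $S$ that exceed $r^I$, in any order. Let $\varsigma\geq 2$ be at least all $\varsigma'$ that occur, and let $R\ge r^I$ be at least all $n^F-k^F$ that occur. **Base code.** A base code is a scalar systematic $[k^I+R,k^I]$ MDS code $\mathcal C'$ that, for every $1\le r\le R$, is the initial code of an access-optimal scalar MDS $(k^I+R,k^I;\varsigma k^I+r,\varsigma k^I)$ convertible code whose final code is systematic and whose conversion procedure reads only from the first $r$ parities of each initial codeword. **Construction.** Put $\mathcal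 C_0=\mathcal C'$. For $i=1,\dots,t$, the code $\mathcal C_i$ consists of $r_i$ instances of $\mathcal C_{i-1}$, where, for all $1\le a\le r^I<b\le r_i$, the $b$-th parity of $\mathcal C_{i-1}$ for the message of instance $a$ is added to the $a$-th parity of instance $b$. Let $\mathcal C$ be $\mathcal C_t$ restricted to its first $n^I$ nodes; its symbols have $\alpha=\prod_{i=1}^t r_i$ subsymbols. **Theorem.** 1. There is $q_0$ such that a base code exists over every finite field with at least $q_0$ elements. 2. For every finite field and every base code over it, $\mathcal C$ is an $[n^I,k^I,\alpha]$ MDS code with $\alpha=\prod_{i=1}^t r_i$, and simultaneously for every $(n^F,k^F)\in S$ it is the initial code of a bandwidth-optimal MDS $(n^I,k^I;n^F,k^F)$ convertible code. If $n^F-k^F\le r^I$, then this convertible code can moreover be chosen access-optimal and instance-wise: the $j$-th subsymbol of each new node is a linear combination of the $j$-th subsymbols of the nodes that are read, with coefficients that do not depend on $j$. -/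

import Mathlib

universe u

/-- An encoding function (generator matrix) for a linear vector code of length `n` over `F` whose
messages consist of `k` symbols.  Message symbols and code symbols are vectors of `α` subsymbols
in `F`. -/
abbrev Encoder (F : Type u) [Field F] (n k α : ℕ) : Type u :=
  (Fin k → Fin α → F) →ₗ[F] (Fin n → Fin α → F)

namespace Encoder

variable {F : Type u} [Field F] {n k α : ℕ}

open Classical in
/-- The code (the image of the encoder) is an `[n, k, α]` MDS code: it has dimension `α * k` over
`F`, and its minimum distance, counted in symbols, is `n - k + 1`. -/
def IsMDS (C : Encoder F n k α) : Prop :=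
  Module.finrank F (LinearMap.range C) = α * k ∧
  IsLeast {d : ℕ | ∃ c ∈ LinearMap.range C, ∃ c' ∈ LinearMap.range C,
    c ≠ c' ∧ hammingDist c c' = d} (n - k + 1)

/-- The encoder maps every message `m` to a codeword that has `m` as a prefix. -/
def IsSystematic (C : Encoder F n k α) : Prop :=
  ∀ (m : Fin k → Fin α → F) (y : Fin n) (hy : (y : ℕ) < k), C m y = m ⟨y, hy⟩

/-- Puncturing: only the first `n'` symbols of every codeword are kept. -/
def puncture {n' : ℕ} (h : n' ≤ n) (C : Encoder F n k α) : Encoder F n' k α where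
  toFun m y := C m (Fin.castLE h y)
  map_add' m m' := by ext; simp
  map_smul' t m := by ext; simp

/-- The message encoded by the `j`-th of `r` instances of a code with `α` subsymbols per symbol:
the subsymbols with index in `[j * α, (j + 1) * α)`. -/
def instanceMessage {r : ℕ} (M : Fin k → Fin (r * α) → F) (j : Fin r) : Fin k → Fin α → F :=
  fun x a => M x (finProdFinEquiv (j, a))

/-- One piggybacking step.  The base code `C` has `k` systematic nodes `0, …, k - 1` and the parity
nodes `k, k + 1, …, n - 1`.  The new code consists of `r` instances of `C`; for `i < rI ≤ j < r`,
the `j`-th parity of `C` for the message of instance `i` is added, as a piggyback, to the `i`-th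
parity node of instance `j`.  Nothing is added to the other nodes (in particular to
the parity nodes `k + rI, …, n - 1`, which the final code of interest punctures).
(The condition `k + j < n` says that `C` has a `j`-th parity; it is automatic if `k + r ≤ n`.) -/
def piggybackStep (rI r : ℕ) (C : Encoder F n k α) : Encoder F n k (r * α) where
  toFun M y b :=
    C (instanceMessage M b.divNat) y b.modNat +
      if h : k ≤ (y : ℕ) ∧ (y : ℕ) < k + rI ∧ rI ≤ (b.divNat : ℕ) ∧ k + (b.divNat : ℕ) < n then
        C (instanceMessage M ⟨(y : ℕ) - k, by have := b.divNat.isLt; omega⟩)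
          ⟨k + (b.divNat : ℕ), h.2.2.2⟩ b.modNat
      else 0
  map_add' M M' := by
    have key : ∀ j : Fin r, instanceMessage (M + M') j =
      instanceMessage M j + instanceMessage M' j := fun _ => rfl
    ext y b
    simp only [key, map_add, Pi.add_apply]
    split_ifs
    · ring
    · ring
  map_smul' t M := by
    have key : ∀ j : Fin r, instanceMessage (t • M) j = t • instanceMessage M j := fun _ => rfl
    ext y b
    simp only [key, map_smul, Pi.smul_apply, RingHom.id_apply, smul_eq_mul]
    split_ifs
    · ring
    · ring

/-- The recursive piggybacking construction: starting from a scalar code, one piggybacking step is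
made for every member of the list, from its last member to its first; each step uses the
result of the step before as its base code. -/
def recursivePiggyback (rI : ℕ) (C : Encoder F n k 1) : (rs : List ℕ) → Encoder F n k rs.prod
  | [] => C
  | r :: rs => piggybackStep rI r (recursivePiggyback rI C rs)

end Encoder

/-- A convertible code in the merge regime, with `[nI, k, α]` initial code and `[nF, ς * k, α]`
final code.  The message `m` consists of `ς` submessages `m s` of `k` symbols each. In the initial
configuration `m s` is the message of the `s`-th initial codeword, in the final configuration
the concatenation of the `m s` is the message of the single final codeword.  (Other partitions of
the message symbols differ from this one only by a relabelling.)

A final node is either an unchanged node, i.e. one of the `ς * nI` initial nodes, or a new node.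
The conversion procedure downloads `β s x ≤ α` subsymbols from node `x` of the initial codeword `s`,
each a function of the content of this node, and it computes the contents of the new nodes from all
that is downloaded. -/
structure ConvertibleCode (F : Type u) [Field F] (nI k nF ς α : ℕ) where
  initial : Encoder F nI k α
  final : Encoder F nF (ς * k) α
  /-- `some (s, x)` if the final node is the unchanged node `x` of the initial codeword `s`,
  and `none` if it is new. -/
  origin : Fin nF → Option (Fin ς × Fin nI)
  origin_injective : ∀ y y' p, origin y = some p → origin y' = some p → y = y'
  β : Fin ς → Fin nI → ℕ
  β_le : ∀ s x, β s x ≤ α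
  download : ∀ s x, (Fin α → F) → (Fin (β s x) → F)
  compute : (∀ s x, Fin (β s x) → F) → Fin nF → Fin α → F
  unchanged : ∀ (m : Fin ς → Fin k → Fin α → F) y s x, origin y = some (s, x) →
    final (fun p => m p.divNat p.modNat) y = initial (m s) x
  new : ∀ (m : Fin ς → Fin k → Fin α → F) y, origin y = none →
    final (fun p => m p.divNat p.modNat) y = compute (fun s x => download s x (initial (m s) x)) y

namespace ConvertibleCode

variable {F : Type u} [Field F] {nI k nF ς α : ℕ}

/-- Both the initial and the final code are MDS. -/
def IsMDS (D : ConvertibleCode F nI k nF ς α) : Prop :=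
  D.initial.IsMDS ∧ D.final.IsMDS

/-- The number of new nodes. -/
def numNew (D : ConvertibleCode F nI k nF ς α) : ℕ :=
  (Finset.univ.filter fun y => D.origin y = none).card

/-- The conversion bandwidth: the number of subsymbols sent from the initial nodes to the
coordinator, plus the number of subsymbols sent from the coordinator to the new nodes. -/
def bandwidth (D : ConvertibleCode F nI k nF ς α) : ℕ :=
  (∑ s, ∑ x, D.β s x) + D.numNew * α

/-- The access cost: the number of code symbols read plus the number of code symbols written. -/
def accessCost (D : ConvertibleCode F nI k nF ς α) : ℕ :=
  (Finset.univ.filter fun p : Fin ς × Fin nI => D.β p.1 p.2 ≠ 0).card + D.numNew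

/-- Minimum access cost among all MDS convertible codes with the same parameters
`(nI, k; nF, ς * k)`. -/
def IsAccessOptimal (D : ConvertibleCode F nI k nF ς α) : Prop :=
  ∀ (F' : Type u) [Field F'] [Fintype F'] (α' : ℕ) (D' : ConvertibleCode F' nI k nF ς α'),
    D'.IsMDS → D.accessCost ≤ D'.accessCost

/-- The lower bound on the conversion bandwidth of MDS convertible codes in the merge regime, where
`rI` and `rF` are the numbers of parities of the initial and of the final code. -/
noncomputable def bandwidthBound (rI rF k ς α : ℕ) : ℝ :=
  if rF ≤ rI ∨ k ≤ rF then (ς : ℝ) * α * min (k : ℝ) rF + rF * α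
  else (ς : ℝ) * α * (rI + k * (1 - (rI : ℝ) / rF)) + rF * α

/-- The conversion bandwidth attains the lower bound, and it is in fact, relative to the size `α` of
a symbol, the minimum among all MDS convertible codes with the same parameters
`(nI, k; nF, ς * k)`. -/
def IsBandwidthOptimal (D : ConvertibleCode F nI k nF ς α) : Prop :=
  (D.bandwidth : ℝ) = bandwidthBound (nI - k) (nF - ς * k) k ς α ∧
  ∀ (F' : Type u) [Field F'] [Fintype F'] (α' : ℕ) (D' : ConvertibleCode F' nI k nF ς α'),
    D'.IsMDS → α' * D.bandwidth ≤ α * D'.bandwidth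

/-- The conversion treats the `α` coordinates of the symbols as independent instances, and all of
them in the same linear way: the subsymbol `a` of a new node is a linear combination, with
coefficients independent of `a`, of the subsymbols `a` of the nodes that are read. -/
def IsInstancewise (D : ConvertibleCode F nI k nF ς α) : Prop :=
  ∃ c : Fin nF → Fin ς → Fin nI → F,
    (∀ y s x, D.β s x = 0 → c y s x = 0) ∧
    ∀ y, D.origin y = none → ∀ (m : Fin ς → Fin k → Fin α → F) (a : Fin α),
      D.final (fun p => m p.divNat p.modNat) y a = ∑ s, ∑ x, c y s x * D.initial (m s) x a

end ConvertibleCode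

/-- The base code of the construction: a scalar systematic linear `[k + R, k]` MDS code which for
every `r ≤ R` is the initial code of an access-optimal MDS convertible code with systematic
`[ς * k + r, ς * k]` final code whose conversion procedure reads nothing but (some of) the first `r`
parities of every initial codeword. -/
structure IsAccessOptimalBase {F : Type u} [Field F] {k R : ℕ} (ς : ℕ)
    (C : Encoder F (k + R) k 1) : Prop where
  systematic : C.IsSystematic
  isMDS : C.IsMDS
  convertible : ∀ r, 1 ≤ r → r ≤ R → ∃ D : ConvertibleCode F (k + R) k (ς * k + r) ς 1,
    D.initial = C ∧ D.IsMDS ∧ D.IsAccessOptimal ∧ D.final.IsSystematic ∧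
    ∀ s (x : Fin (k + R)), D.β s x ≠ 0 → k ≤ (x : ℕ) ∧ (x : ℕ) < k + r

/-!
The theorem has three ingredients.

*Lower bounds* (`card_kept_le`, `sum_beta_kept_le`, `bandwidthBound_le`, `le_accessCost`).  At most
`k` nodes of an initial codeword `s` can be kept, because `k + 1` of them would be dependent in the
final code.  If `r` is the number of parities of the final code, any `r` kept nodes of `s` can be
erased from the final codeword without losing its message.  The message of `s` is then a function
of the other kept nodes and of the downloads from all remaining nodes, so that counting bounds these
downloads from below; nothing need be linear here.  Erasing the kept nodes with the smallest
downloads gives the bound on the bandwidth, and the bound on the access cost follows, since a node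
provides at most `α` subsymbols.

*Conversions.* Apart from being systematic and MDS, a base code is used in one way only
(`IsAccessOptimalBase.exists_combineParity`): the parities of its final codes are linear
combinations of the first `r` parities of the initial codewords. All codes built from it by
piggybacking are triangular, in that an instance is a codeword of the previous code plus a
function of earlier instances. Hence decodability, and with it the MDS property, passes from step
to step (`IsDecodable.of_triangular`); this holds for the initial codes and for the final codes
obtained by combining parities. Let `rI` be the number of parities of the initial code. If
`k ≤ r`, encoding anew is optimal; otherwise, if `r ≤ rI`, combining the first `r` parities is. If
`rI < r < k`, there is a piggybacking step with `r` instances. Its later instances are decoded from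
their systematic nodes; their downloaded parities then reveal the piggybacks, which are just the
parities missing from the earlier instances (`isConvertibleReading_piggybackStep`). The steps
after it only add piggybacks to the final code, which stays triangular
(`IsConvertibleReading.piggybackStep`).

*Existence of base codes.*  Vandermonde codes, with parity `∑ x, m x * θ y ^ x`, can be merged by
multiplying parities by powers of `θ y`.  They and all their final codes are MDS if no nonzero
polynomial of small degree has as many zeros among the `θ y` as nonzero coefficients, and over a
large field such points can be chosen one after the other
(`exists_finset_card_roots_lt_card_support`).
-/

/-! ### MDS codes and decodability -/

theorem divNat_finProdFinEquiv {m n : ℕ} (i : Fin m) (j : Fin n) :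
    (finProdFinEquiv (i, j)).divNat = i :=
  congrArg Prod.fst (finProdFinEquiv.symm_apply_apply (i, j))

theorem modNat_finProdFinEquiv {m n : ℕ} (i : Fin m) (j : Fin n) :
    (finProdFinEquiv (i, j)).modNat = j :=
  congrArg Prod.snd (finProdFinEquiv.symm_apply_apply (i, j))

namespace Encoder

variable {F : Type u} [Field F] {n k α : ℕ}

/-- Every message is determined by any `k` symbols of its codeword. -/
def IsDecodable (C : Encoder F n k α) : Prop :=
  ∀ Z : Finset (Fin n), k ≤ Z.card → ∀ m, (∀ y ∈ Z, C m y = 0) → m = 0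

theorem IsDecodable.eq {C : Encoder F n k α} (hC : C.IsDecodable) {Z : Finset (Fin n)}
    (hZ : k ≤ Z.card) {m m' : Fin k → Fin α → F} (h : ∀ y ∈ Z, C m y = C m' y) : m = m' := by
  rw [← sub_eq_zero]
  refine hC Z hZ _ fun y hy => ?_
  rw [map_sub, Pi.sub_apply, h y hy, sub_self]

/-- Fewer than `k` symbols never determine the message. -/
theorem exists_ne_zero_vanishing (C : Encoder F n k α) (hα : 0 < α) (Z : Finset (Fin n))
    (hZ : Z.card < k) : ∃ m ≠ 0, ∀ y ∈ Z, C m y = 0 := by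
  let T : (Fin k → Fin α → F) →ₗ[F] (Z → Fin α → F) :=
    (LinearMap.funLeft F (Fin α → F) (fun y : Z => (y : Fin n))).comp C
  have hT : LinearMap.ker T ≠ ⊥ := by
    apply LinearMap.ker_ne_bot_of_finrank_lt
    simp only [Module.finrank_pi_fintype, Module.finrank_self, Finset.sum_const, Finset.card_univ,
      Fintype.card_fin, Fintype.card_coe, smul_eq_mul, mul_one]
    exact Nat.mul_lt_mul_of_pos_right hZ hα
  obtain ⟨m, hm, hne⟩ := (Submodule.ne_bot_iff _).1 hT
  exact ⟨m, hne, fun y hy => congrFun (LinearMap.mem_ker.1 hm) ⟨y, hy⟩⟩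

theorem IsMDS.pos {C : Encoder F n k α} (hC : C.IsMDS) : 0 < α := by
  obtain ⟨-, ⟨c, -, c', -, hne, -⟩, -⟩ := hC
  rcases Nat.eq_zero_or_pos α with rfl | h
  · exact absurd (Subsingleton.elim c c') hne
  · exact h

theorem IsMDS.isDecodable {C : Encoder F n k α} (hC : C.IsMDS) : C.IsDecodable := by
  obtain ⟨hrank, -, hmin⟩ := hC
  have hinj : Function.Injective C := by
    rw [← LinearMap.ker_eq_bot, ← Submodule.finrank_eq_zero (R := F)]
    have := LinearMap.finrank_range_add_finrank_ker C
    rw [hrank] at this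
    simp only [Module.finrank_pi_fintype, Module.finrank_self, Finset.sum_const, Finset.card_univ,
      Fintype.card_fin, smul_eq_mul, mul_one] at this
    rw [mul_comm k] at this
    omega
  intro Z hZ m hm
  by_contra hne
  have h0 : C m ≠ 0 := fun h => hne (hinj (by rw [h, map_zero]))
  have h := hmin ⟨C m, ⟨m, rfl⟩, 0, ⟨0, map_zero C⟩, h0, rfl⟩
  classical
  have h2 : hammingDist (C m) 0 ≤ Zᶜ.card := by
    unfold hammingDist
    refine Finset.card_le_card fun y hy => ?_
    simp only [Finset.mem_filter, Finset.mem_univ, true_and, Pi.zero_apply] at hy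
    simpa using fun hyZ => hy (hm y hyZ)
  rw [Finset.card_compl, Fintype.card_fin] at h2
  have h3 : n - k + 1 ≤ hammingDist (C m) 0 := by convert h
  omega

theorem IsDecodable.isMDS {C : Encoder F n k α} (hC : C.IsDecodable) (hk : 0 < k) (hkn : k ≤ n)
    (hα : 0 < α) : C.IsMDS := by
  classical
  have hinj : Function.Injective C := fun m m' h =>
    hC.eq (Z := Finset.univ) (by simpa using hkn) fun y _ => congrFun h y
  have hdist : ∀ c c' : Fin n → Fin α → F,
      hammingDist c c' + (Finset.univ.filter fun y => c y = c' y).card = n := by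
    intro c c'
    have := Finset.card_filter_add_card_filter_not (s := (Finset.univ : Finset (Fin n)))
      (fun y => c y = c' y)
    rw [Finset.card_univ, Fintype.card_fin] at this
    rw [add_comm]
    exact this
  have hlt : ∀ m m', m ≠ m' → (Finset.univ.filter fun y => C m y = C m' y).card < k := by
    intro m m' hne
    by_contra! h
    exact hne (hC.eq h fun y hy => by simpa using hy)
  refine ⟨?_, ?_, ?_⟩
  · rw [LinearMap.finrank_range_of_inj hinj]
    simp [Module.finrank_pi_fintype, mul_comm]
  · obtain ⟨Z, -, hZ⟩ := Finset.exists_subset_card_eq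
      (show k - 1 ≤ (Finset.univ : Finset (Fin n)).card by simp; omega)
    obtain ⟨m, hne, hm⟩ := C.exists_ne_zero_vanishing hα Z (by omega)
    refine ⟨C m, ⟨m, rfl⟩, 0, ⟨0, map_zero C⟩, fun h => hne (hinj (by rw [h, map_zero])), ?_⟩
    have h1 := hlt m 0 hne
    have h2 : Z.card ≤ (Finset.univ.filter fun y => C m y = C 0 y).card :=
      Finset.card_le_card fun y hy => by simp [hm y hy]
    have h3 := hdist (C m) (C 0)
    rw [map_zero] at h1 h2 h3
    have h4 : hammingDist (C m) 0 = n - k + 1 := by omega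
    convert h4
  · rintro d ⟨_, ⟨m, rfl⟩, _, ⟨m', rfl⟩, hne, rfl⟩
    have h1 := hlt m m' fun h => hne (by rw [h])
    have h3 := hdist (C m) (C m')
    have h4 : n - k + 1 ≤ hammingDist (C m) (C m') := by omega
    convert h4

/-- Instance `j` of the codewords of `C'` is a codeword of `C`, up to a summand that depends only
on the messages of the instances before `rI` and that is absent if `j < rI` itself.  The instances
can then be decoded one after the other. -/
theorem IsDecodable.of_triangular {C : Encoder F n k α} (hC : C.IsDecodable) {r : ℕ} (rI : ℕ)
    {C' : Encoder F n k (r * α)}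
    (h : ∀ m (j : Fin r), ((j : ℕ) < rI ∨ ∀ a : Fin r, (a : ℕ) < rI → instanceMessage m a = 0) →
      ∀ y t, C' m y (finProdFinEquiv (j, t)) = C (instanceMessage m j) y t) :
    C'.IsDecodable := by
  intro Z hZ m hm
  have key : ∀ j : Fin r, ((j : ℕ) < rI ∨ ∀ a : Fin r, (a : ℕ) < rI → instanceMessage m a = 0) →
      instanceMessage m j = 0 := fun j hj =>
    hC Z hZ _ fun y hy => funext fun t => by rw [← h m j hj, hm y hy]; rfl
  have hall : ∀ j : Fin r, instanceMessage m j = 0 := fun j =>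
    key j (.inr fun a ha => key a (.inl ha))
  ext x b
  have := congrFun (congrFun (hall b.divNat) x) b.modNat
  have hb : finProdFinEquiv (b.divNat, b.modNat) = b := finProdFinEquiv.apply_symm_apply b
  rwa [instanceMessage, hb] at this

theorem IsDecodable.puncture {n' : ℕ} {C : Encoder F n k α} (hC : C.IsDecodable) (h : n' ≤ n) :
    (C.puncture h).IsDecodable := fun Z hZ m hm =>
  hC (Z.map (Fin.castLEEmb h)) (by simpa using hZ) m fun y hy => by
    obtain ⟨z, hz, rfl⟩ := Finset.mem_map.1 hy
    exact hm z hz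

theorem piggybackStep_apply (rI r : ℕ) (C : Encoder F n k α) (m : Fin k → Fin (r * α) → F)
    (y : Fin n) (j : Fin r) (t : Fin α) :
    piggybackStep rI r C m y (finProdFinEquiv (j, t)) =
      C (instanceMessage m j) y t +
      if h : k ≤ (y : ℕ) ∧ (y : ℕ) < k + rI ∧ rI ≤ (j : ℕ) ∧ k + (j : ℕ) < n then
        C (instanceMessage m ⟨(y : ℕ) - k, by have := j.isLt; omega⟩) ⟨k + (j : ℕ), h.2.2.2⟩ t
      else 0 := by
  change C (instanceMessage m (finProdFinEquiv (j, t)).divNat) y (finProdFinEquiv (j, t)).modNat +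
    (if h : k ≤ (y : ℕ) ∧ (y : ℕ) < k + rI ∧ rI ≤ ((finProdFinEquiv (j, t)).divNat : ℕ) ∧
        k + ((finProdFinEquiv (j, t)).divNat : ℕ) < n then
      C (instanceMessage m ⟨(y : ℕ) - k, _⟩)
        ⟨k + ((finProdFinEquiv (j, t)).divNat : ℕ), h.2.2.2⟩ (finProdFinEquiv (j, t)).modNat
      else 0) = _
  simp only [divNat_finProdFinEquiv, modNat_finProdFinEquiv]

theorem piggybackStep_triangular {rI r : ℕ} (C : Encoder F n k α) (m : Fin k → Fin (r * α) → F)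
    (j : Fin r) (hj : (j : ℕ) < rI ∨ ∀ a : Fin r, (a : ℕ) < rI → instanceMessage m a = 0)
    (y : Fin n) (t : Fin α) :
    piggybackStep rI r C m y (finProdFinEquiv (j, t)) = C (instanceMessage m j) y t := by
  rw [piggybackStep_apply]
  split_ifs with h
  · obtain hj | hj := hj
    · omega
    · rw [hj ⟨(y : ℕ) - k, by have := j.isLt; omega⟩ (show (y : ℕ) - k < rI by omega)]
      simp
  · rw [add_zero]

theorem IsDecodable.recursivePiggyback {C : Encoder F n k 1} (hC : C.IsDecodable) (rI : ℕ) :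
    ∀ rs : List ℕ, (C.recursivePiggyback rI rs).IsDecodable
  | [] => hC
  | _ :: rs => (hC.recursivePiggyback rI rs).of_triangular rI
      fun m j hj y t => piggybackStep_triangular _ m j hj y t

theorem IsSystematic.piggybackStep {C : Encoder F n k α} (hC : C.IsSystematic) (rI r : ℕ) :
    (C.piggybackStep rI r).IsSystematic := by
  intro m y hy
  ext b
  obtain ⟨⟨j, t⟩, rfl⟩ := finProdFinEquiv.surjective b
  rw [piggybackStep_apply, dif_neg (by omega), add_zero, hC _ y hy]
  rfl

theorem IsSystematic.recursivePiggyback {C : Encoder F n k 1} (hC : C.IsSystematic) (rI : ℕ) :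
    ∀ rs : List ℕ, (C.recursivePiggyback rI rs).IsSystematic
  | [] => hC
  | r :: rs => (hC.recursivePiggyback rI rs).piggybackStep rI r

theorem IsSystematic.puncture {n' : ℕ} {C : Encoder F n k α} (hC : C.IsSystematic) (h : n' ≤ n) :
    (C.puncture h).IsSystematic := fun m y hy => hC m (Fin.castLE h y) hy

/-- The systematic code whose parities are the symbols of `G m`. -/
def appendParity {r : ℕ} (G : (Fin k → Fin α → F) →ₗ[F] (Fin r → Fin α → F)) :
    Encoder F (k + r) k α where
  toFun m := Fin.append m (G m)
  map_add' m m' := by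
    ext y
    refine Fin.addCases (fun x => ?_) (fun x => ?_) y <;> simp
  map_smul' t m := by
    ext y
    refine Fin.addCases (fun x => ?_) (fun x => ?_) y <;> simp

@[simp]
theorem appendParity_castAdd {r : ℕ} (G : (Fin k → Fin α → F) →ₗ[F] (Fin r → Fin α → F))
    (m : Fin k → Fin α → F) (x : Fin k) : appendParity G m (Fin.castAdd r x) = m x :=
  Fin.append_left _ _ x

@[simp]
theorem appendParity_natAdd {r : ℕ} (G : (Fin k → Fin α → F) →ₗ[F] (Fin r → Fin α → F))
    (m : Fin k → Fin α → F) (y : Fin r) : appendParity G m (Fin.natAdd k y) = G m y :=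
  Fin.append_right _ _ y

theorem appendParity_isSystematic {r : ℕ}
    (G : (Fin k → Fin α → F) →ₗ[F] (Fin r → Fin α → F)) : (appendParity G).IsSystematic := by
  intro m y hy
  exact appendParity_castAdd G m ⟨y, hy⟩

theorem IsSystematic.eq_appendParity {r : ℕ} {C : Encoder F (k + r) k α} (hC : C.IsSystematic)
    {G : (Fin k → Fin α → F) →ₗ[F] (Fin r → Fin α → F)}
    (hG : ∀ m y, G m y = C m (Fin.natAdd k y)) : appendParity G = C := by
  refine LinearMap.ext fun m => funext fun y => ?_
  refine Fin.addCases (fun x => ?_) (fun x => ?_) y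
  · rw [appendParity_castAdd, hC m _ (by simp)]; rfl
  · rw [appendParity_natAdd, hG]

/-- In terms of the parity map, decodability says that every square submatrix (of `α × α` blocks)
of the parity matrix is invertible: a message supported on `X` whose parities in `Y` vanish is `0`
if `|X| ≤ |Y|`. -/
theorem appendParity_isDecodable_iff {r : ℕ}
    {G : (Fin k → Fin α → F) →ₗ[F] (Fin r → Fin α → F)} :
    (appendParity G).IsDecodable ↔ ∀ (X : Finset (Fin k)) (Y : Finset (Fin r)), X.card ≤ Y.card →
      ∀ m, (∀ x ∉ X, m x = 0) → (∀ y ∈ Y, G m y = 0) → m = 0 := by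
  classical
  constructor
  · intro h X Y hXY m hX hY
    refine h (Xᶜ.map (Fin.castAddEmb r) ∪ Y.map (Fin.natAddEmb k)) ?_ m fun y hy => ?_
    · rw [Finset.card_union_of_disjoint, Finset.card_map, Finset.card_map, Finset.card_compl,
        Fintype.card_fin]
      · have := X.card_le_univ
        rw [Fintype.card_fin] at this
        omega
      · rw [Finset.disjoint_left]
        simp only [Finset.mem_map, not_exists, not_and]
        rintro _ ⟨a, -, rfl⟩ b - hab
        have := congrArg Fin.val hab
        simp at this
        omega
    · rw [Finset.mem_union, Finset.mem_map, Finset.mem_map] at hy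
      obtain ⟨x, hx, rfl⟩ | ⟨x, hx, rfl⟩ := hy
      · simpa using hX x (by simpa using hx)
      · simpa using hY x hx
  · intro h Z hZ m hm
    refine h (Finset.univ.filter fun x => Fin.castAdd r x ∉ Z)
      (Finset.univ.filter fun y => Fin.natAdd k y ∈ Z) ?_ m ?_ ?_
    · have h1 := Finset.card_filter_add_card_filter_not (s := (Finset.univ : Finset (Fin k)))
        (fun x => Fin.castAdd r x ∈ Z)
      have h2 : Z.card ≤ (Finset.univ.filter fun x => Fin.castAdd r x ∈ Z).card +
          (Finset.univ.filter fun y => Fin.natAdd k y ∈ Z).card := by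
        rw [← Finset.card_map (s := Finset.univ.filter fun x => Fin.castAdd r x ∈ Z)
            (Fin.castAddEmb r),
          ← Finset.card_map (s := Finset.univ.filter fun y => Fin.natAdd k y ∈ Z) (Fin.natAddEmb k)]
        refine le_trans (Finset.card_le_card fun z hz => ?_) (Finset.card_union_le _ _)
        revert hz
        refine Fin.addCases (fun x => ?_) (fun x => ?_) z <;> intro hz <;>
          simp only [Finset.mem_union, Finset.mem_map, Finset.mem_filter, Finset.mem_univ, true_and]
        · exact .inl ⟨x, hz, rfl⟩
        · exact .inr ⟨x, hz, rfl⟩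
      rw [Finset.card_univ, Fintype.card_fin] at h1
      omega
    · intro x hx
      simpa using hm (Fin.castAdd r x) (by simpa using hx)
    · intro y hy
      simpa using hm (Fin.natAdd k y) (by simpa using hy)

end Encoder

/-! ### Lower bounds on access cost and bandwidth -/

namespace ConvertibleCode

variable {F : Type u} [Field F] {nI k nF ς α : ℕ}

open Classical in
/-- The nodes of the initial codeword `s` that are final nodes as well. -/
noncomputable def kept (D : ConvertibleCode F nI k nF ς α) (s : Fin ς) : Finset (Fin nI) :=
  Finset.univ.filter fun x => ∃ y, D.origin y = some (s, x)

theorem mem_kept {D : ConvertibleCode F nI k nF ς α} {s : Fin ς} {x : Fin nI} :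
    x ∈ D.kept s ↔ ∃ y, D.origin y = some (s, x) := by
  simp [kept]

/-- At most `k` nodes of an initial codeword are kept: `k + 1` of them are dependent, whereas any
`k + 1 ≤ ς * k` nodes of the final codeword are independent. -/
theorem card_kept_le {D : ConvertibleCode F nI k nF ς α} (hD : D.IsMDS) (hk : 0 < k) (hς : 2 ≤ ς)
    (hnF : ς * k ≤ nF) (s : Fin ς) : (D.kept s).card ≤ k := by
  classical
  by_contra! hlt
  obtain ⟨x₀, hx₀⟩ : (D.kept s).Nonempty := Finset.card_pos.1 (by omega)
  obtain ⟨W, hW, hWcard⟩ := Finset.exists_subset_card_eq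
    (show k ≤ ((D.kept s).erase x₀).card by rw [Finset.card_erase_of_mem hx₀]; omega)
  obtain ⟨y₀, hy₀⟩ := mem_kept.1 hx₀
  have : Nonempty (Fin nF) := ⟨y₀⟩
  choose! g hg using fun x (hx : x ∈ D.kept s) => mem_kept.1 hx
  have hg' : ∀ x ∈ W, D.origin (g x) = some (s, x) := fun x hx =>
    hg x (Finset.mem_of_mem_erase (hW hx))
  have hginj : Set.InjOn g W := by
    intro x hx x' hx' h
    have h1 := hg' x hx
    rw [h, hg' x' hx'] at h1
    simpa using h1.symm
  have h2k : 2 * k ≤ ς * k := Nat.mul_le_mul_right k hς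
  obtain ⟨Z, hZ1, hZ2, hZ⟩ := Finset.exists_subsuperset_card_eq
    (s := W.image g) (t := Finset.univ.erase y₀) (n := ς * k - 1)
    (fun y hy => by
      obtain ⟨x, hx, rfl⟩ := Finset.mem_image.1 hy
      refine Finset.mem_erase.2 ⟨fun h => ?_, Finset.mem_univ _⟩
      have h1 := hg' x hx
      rw [h, hy₀] at h1
      exact Finset.ne_of_mem_erase (hW hx) (by simpa using h1.symm))
    (by rw [Finset.card_image_of_injOn hginj]; omega)
    (by rw [Finset.card_erase_of_mem (Finset.mem_univ _), Finset.card_univ, Fintype.card_fin]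
        omega)
  obtain ⟨m, hne, hm⟩ := D.final.exists_ne_zero_vanishing hD.1.pos Z (by omega)
  have hfl : (fun p : Fin (ς * k) => (fun s x => m (finProdFinEquiv (s, x))) p.divNat p.modNat)
      = m := funext fun p => congrArg m (finProdFinEquiv.apply_symm_apply p)
  have hun := D.unchanged fun s x => m (finProdFinEquiv (s, x))
  rw [hfl] at hun
  have h0 : (fun x => m (finProdFinEquiv (s, x))) = 0 := by
    refine hD.1.isDecodable W hWcard.ge _ fun x hx => ?_
    rw [← hun (g x) s x (hg' x hx)]
    exact hm _ (hZ1 (Finset.mem_image_of_mem g hx))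
  refine hne (hD.2.isDecodable (insert y₀ Z) ?_ m fun y hy => ?_)
  · rw [Finset.card_insert_of_notMem fun h => by simpa using hZ2 h]
    omega
  · obtain rfl | hy := Finset.mem_insert.1 hy
    · rw [hun _ s x₀ hy₀, h0, map_zero]
      rfl
    · exact hm y hy

theorem le_numNew {D : ConvertibleCode F nI k nF ς α} (hD : D.IsMDS) (hk : 0 < k) (hς : 2 ≤ ς)
    (hnF : ς * k ≤ nF) : nF ≤ D.numNew + ς * k := by
  classical
  rcases nF.eq_zero_or_pos with rfl | hpos
  · exact Nat.zero_le _
  have : Nonempty (Fin nF) := ⟨⟨0, hpos⟩⟩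
  have h1 := Finset.card_filter_add_card_filter_not (s := (Finset.univ : Finset (Fin nF)))
    (fun y => D.origin y = none)
  rw [Finset.card_univ, Fintype.card_fin] at h1
  choose! g hg using fun s x (hx : x ∈ D.kept s) => mem_kept.1 hx
  have h2 : (Finset.univ.filter fun y => ¬ D.origin y = none).card ≤ ∑ _s : Fin ς, k := by
    calc _ ≤ (Finset.univ.biUnion fun s => (D.kept s).image (g s)).card := by
          refine Finset.card_le_card fun y hy => ?_
          obtain ⟨⟨s, x⟩, h⟩ := Option.ne_none_iff_exists'.1 (Finset.mem_filter.1 hy).2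
          have hx : x ∈ D.kept s := mem_kept.2 ⟨y, h⟩
          refine Finset.mem_biUnion.2 ⟨s, Finset.mem_univ _, Finset.mem_image.2 ⟨x, hx, ?_⟩⟩
          exact D.origin_injective _ _ _ (hg s x hx) h
      _ ≤ ∑ s, ((D.kept s).image (g s)).card := Finset.card_biUnion_le
      _ ≤ ∑ _s : Fin ς, k := Finset.sum_le_sum fun s _ =>
          Finset.card_image_le.trans (card_kept_le hD hk hς hnF s)
  rw [Finset.sum_const, Finset.card_univ, Fintype.card_fin, smul_eq_mul] at h2
  unfold numNew
  omega

/-- If kept nodes `A` of the initial codeword `s` are erased from the final codeword and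
`ς * k` nodes are left, then the message of `s` can still be recovered.  So it is determined by the
other kept nodes together with what is downloaded from the remaining nodes. -/
theorem card_message_le [Fintype F] {D : ConvertibleCode F nI k nF ς α} (hD : D.IsMDS) (s : Fin ς)
    {A : Finset (Fin nI)} (hA : A ⊆ D.kept s) (hcard : A.card + ς * k ≤ nF) :
    α * k ≤ α * (D.kept s \ A).card + ∑ x ∈ (D.kept s \ A)ᶜ, D.β s x := by
  classical
  rcases nF.eq_zero_or_pos with rfl | hpos
  · have hς : ς ≠ 0 := s.pos.ne'
    have hk : k = 0 := (Nat.mul_eq_zero.1 (by omega : ς * k = 0)).resolve_left hς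
    simp [hk]
  have : Nonempty (Fin nF) := ⟨⟨0, hpos⟩⟩
  set W := D.kept s \ A with hW
  let φ : (Fin k → Fin α → F) →
      (W → Fin α → F) × (∀ x : {x // x ∈ Wᶜ}, Fin (D.β s x) → F) :=
    fun m => (fun x => D.initial m x, fun x => D.download s x (D.initial m x))
  have hφ : Function.Injective φ := by
    intro m m' h
    have hW1 : ∀ x ∈ W, D.initial m x = D.initial m' x := fun x hx =>
      congrFun (congrArg Prod.fst h) ⟨x, hx⟩
    have hdl : ∀ x, D.download s x (D.initial m x) = D.download s x (D.initial m' x) := by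
      intro x
      by_cases hx : x ∈ W
      · rw [hW1 x hx]
      · exact congrFun (congrArg Prod.snd h) ⟨x, Finset.mem_compl.2 hx⟩
    choose! g hg using fun x (hx : x ∈ D.kept s) => mem_kept.1 hx
    let M : (Fin k → Fin α → F) → Fin ς → Fin k → Fin α → F := fun m => Function.update 0 s m
    have hM : ∀ s' x, D.download s' x (D.initial (M m s') x) =
        D.download s' x (D.initial (M m' s') x) := by
      intro s' x
      by_cases hs : s' = s
      · subst hs
        simp only [M, Function.update_self, hdl]
      · simp only [M, Function.update_of_ne hs]
    have hfin := hD.2.isDecodable.eq (Z := (A.image g)ᶜ) (m := fun p => M m p.divNat p.modNat)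
      (m' := fun p => M m' p.divNat p.modNat) (by
        rw [Finset.card_compl, Fintype.card_fin]
        have := Finset.card_image_le (s := A) (f := g)
        omega) (by
        intro y hy
        rcases ho : D.origin y with _ | ⟨s', x⟩
        · rw [D.new _ y ho, D.new _ y ho]
          simp only [hM]
        · rw [D.unchanged _ y _ _ ho, D.unchanged _ y _ _ ho]
          by_cases hs : s' = s
          · subst hs
            have hxk : x ∈ D.kept s' := mem_kept.2 ⟨y, ho⟩
            simp only [M, Function.update_self]
            refine hW1 x (Finset.mem_sdiff.2 ⟨hxk, fun hxA => ?_⟩)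
            refine Finset.mem_compl.1 hy (Finset.mem_image.2 ⟨x, hxA, ?_⟩)
            exact D.origin_injective _ _ _ (hg x hxk) ho
          · simp only [M, Function.update_of_ne hs])
    funext x
    have := congrFun hfin (finProdFinEquiv (s, x))
    simpa only [divNat_finProdFinEquiv, modNat_finProdFinEquiv, M, Function.update_self] using this
  have hle := Fintype.card_le_of_injective φ hφ
  simp only [Fintype.card_prod, Fintype.card_pi, Finset.prod_const, Finset.card_univ,
    Fintype.card_fin, Fintype.card_coe] at hle
  rw [← Finset.prod_subtype Wᶜ (fun _ => Iff.rfl) (fun x => Fintype.card F ^ D.β s x),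
    Finset.prod_pow_eq_pow_sum, ← pow_mul, ← pow_mul, ← pow_add] at hle
  exact (Nat.pow_le_pow_iff_right Fintype.one_lt_card).1 hle

theorem sum_beta_kept_le [Fintype F] {D : ConvertibleCode F nI k nF ς α} (hD : D.IsMDS) (s : Fin ς)
    {A : Finset (Fin nI)} (hA : A ⊆ D.kept s) (hcard : A.card + ς * k ≤ nF) :
    α * k + α * A.card ≤
      α * (D.kept s).card + ((∑ x ∈ A, D.β s x) + ∑ x ∈ (D.kept s)ᶜ, D.β s x) := by
  classical
  have h := card_message_le hD s hA hcard
  have h1 : (D.kept s \ A)ᶜ = A ∪ (D.kept s)ᶜ := by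
    ext x
    simp only [Finset.mem_compl, Finset.mem_sdiff, Finset.mem_union]
    tauto
  have h2 : Disjoint A (D.kept s)ᶜ := by
    rw [Finset.disjoint_left]
    intro x hx hx'
    exact Finset.mem_compl.1 hx' (hA hx)
  rw [h1, Finset.sum_union h2] at h
  have h3 := Finset.card_sdiff_add_card_eq_card hA
  rw [← h3, mul_add]
  omega

/-- At least `min k (nF - ς * k)` symbols are downloaded from every initial codeword. -/
theorem mul_min_le_sum_beta [Fintype F] {D : ConvertibleCode F nI k nF ς α} (hD : D.IsMDS)
    (hk : 0 < k) (hς : 2 ≤ ς) (hnF : ς * k ≤ nF) (s : Fin ς) :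
    α * min k (nF - ς * k) ≤ ∑ x, D.β s x := by
  classical
  have hu := card_kept_le hD hk hς hnF s
  obtain ⟨A, hA, hAcard⟩ := Finset.exists_subset_card_eq
    (show min (nF - ς * k) (D.kept s).card ≤ (D.kept s).card from min_le_right _ _)
  have h := sum_beta_kept_le hD s hA (by omega)
  have h1 : (∑ x ∈ A, D.β s x) + ∑ x ∈ (D.kept s)ᶜ, D.β s x ≤ ∑ x, D.β s x := by
    rw [← Finset.sum_add_sum_compl (D.kept s)]
    exact Nat.add_le_add_right (Finset.sum_le_sum_of_subset hA) _
  have h2 : min k (nF - ς * k) + (D.kept s).card ≤ k + A.card := by omega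
  have h3 := Nat.mul_le_mul_left α h2
  rw [mul_add, mul_add] at h3
  omega

/-- Among the subsets of given size, the one with the smallest values has at most the proportional
share of a sum. -/
theorem exists_subset_card_mul_sum_le {ι : Type*} [DecidableEq ι] (f : ι → ℕ) (r : ℕ)
    (U : Finset ι) (hr : r ≤ U.card) :
    ∃ A ⊆ U, A.card = r ∧ U.card * ∑ x ∈ A, f x ≤ r * ∑ x ∈ U, f x := by
  induction hr using Nat.decreasingInduction with
  | self => exact ⟨U, subset_rfl, rfl, le_rfl⟩
  | of_succ r hr ih =>
    obtain ⟨A, hAU, hA, hle⟩ := ih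
    obtain ⟨x, hx, hmax⟩ := A.exists_max_image f (Finset.card_pos.1 (by omega))
    refine ⟨A.erase x, (A.erase_subset x).trans hAU, by rw [Finset.card_erase_of_mem hx, hA]; rfl,
      ?_⟩
    have h1 : ∑ y ∈ A.erase x, f y ≤ r * f x := by
      have := Finset.sum_le_card_nsmul (A.erase x) f (f x) fun y hy =>
        hmax y (Finset.mem_of_mem_erase hy)
      rwa [Finset.card_erase_of_mem hx, hA, smul_eq_mul] at this
    have h2 := Finset.sum_erase_add A f hx
    -- the value that is removed is at least the average over `A`
    have h3 : (r + 1) * ∑ y ∈ A.erase x, f y ≤ r * ∑ y ∈ A, f y := by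
      rw [← h2]
      nlinarith
    refine Nat.le_of_mul_le_mul_left (c := r + 1) ?_ r.succ_pos
    calc (r + 1) * (U.card * ∑ y ∈ A.erase x, f y)
        = U.card * ((r + 1) * ∑ y ∈ A.erase x, f y) := by ring
      _ ≤ U.card * (r * ∑ y ∈ A, f y) := Nat.mul_le_mul_left _ h3
      _ = r * (U.card * ∑ y ∈ A, f y) := by ring
      _ ≤ r * ((r + 1) * ∑ y ∈ U, f y) := Nat.mul_le_mul_left _ hle
      _ = (r + 1) * (r * ∑ y ∈ U, f y) := by ring

/-- The lower bound for a final code with more parities than the initial one, but fewer than `k`.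
Erase the `r` kept nodes with the smallest downloads, or all kept nodes if they are fewer.  Their
downloads are at most the average, and the nodes that are not kept contribute at most `α` each.
The bound is weakest if `k` nodes are kept. -/
theorem piggyback_bound_le_sum_beta [Fintype F] {D : ConvertibleCode F nI k nF ς α} (hD : D.IsMDS)
    (hk : 0 < k) (hς : 2 ≤ ς) {rI r : ℕ} (hnI : nI = k + rI) (hnF : nF = ς * k + r) (hrI : rI < r)
    (hrk : r < k) (s : Fin ς) :
    (α : ℝ) * (rI + k * (1 - (rI : ℝ) / r)) ≤ ((∑ x, D.β s x : ℕ) : ℝ) := by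
  classical
  have hu := card_kept_le hD hk hς (by omega) s
  have hr : (0 : ℝ) < r := by exact_mod_cast (show 0 < r by omega)
  have hrI' : (rI : ℝ) < r := by exact_mod_cast hrI
  have hrk' : (r : ℝ) < k := by exact_mod_cast hrk
  have hα : (0 : ℝ) ≤ α := by positivity
  have hrI0 : (0 : ℝ) ≤ rI := by positivity
  suffices h : (α : ℝ) * (rI * r + k * (r - rI)) ≤ r * ((∑ x, D.β s x : ℕ) : ℝ) by
    rw [← mul_le_mul_iff_right₀ hr]
    refine le_of_eq_of_le ?_ h
    field_simp
  by_cases hru : r ≤ (D.kept s).card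
  · obtain ⟨A, hA, hAcard, havg⟩ := exists_subset_card_mul_sum_le (D.β s) r (D.kept s) hru
    have h := sum_beta_kept_le hD s hA (by omega)
    have hT : ∑ x ∈ (D.kept s)ᶜ, D.β s x ≤ (k + rI - (D.kept s).card) * α := by
      refine (Finset.sum_le_card_nsmul _ _ α fun x _ => D.β_le s x).trans ?_
      rw [Finset.card_compl, Fintype.card_fin, smul_eq_mul, ← hnI]
    have hsum := Finset.sum_add_sum_compl (D.kept s) (D.β s)
    rw [← hsum]
    rw [hAcard] at h
    generalize (D.kept s).card = w at *
    generalize ∑ x ∈ (D.kept s)ᶜ, D.β s x = T at *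
    generalize ∑ x ∈ A, D.β s x = a at *
    generalize ∑ x ∈ D.kept s, D.β s x = b at *
    have h' : (α : ℝ) * k + α * r ≤ α * w + (a + T) := by exact_mod_cast h
    have havg' : (w : ℝ) * a ≤ r * b := by exact_mod_cast havg
    have hT' : (T : ℝ) ≤ (k + rI - w) * α := by
      have : ((k + rI - w : ℕ) : ℝ) = k + rI - w := by
        rw [Nat.cast_sub (by omega)]; push_cast; ring
      rw [← this]; exact_mod_cast hT
    have hwk : (w : ℝ) ≤ k := by exact_mod_cast hu
    have hrw : (r : ℝ) ≤ w := by exact_mod_cast hru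
    push_cast
    have e1 : (w : ℝ) * (α * k + α * r - α * w - T) ≤ w * a :=
      mul_le_mul_of_nonneg_left (by linarith) (by positivity)
    have e2 : ((w : ℝ) - r) * T ≤ (w - r) * ((k + rI - w) * α) :=
      mul_le_mul_of_nonneg_left hT' (by linarith)
    have e3 : 0 ≤ (α : ℝ) * rI * (k - w) :=
      mul_nonneg (mul_nonneg hα hrI0) (by linarith)
    nlinarith
  · have h := sum_beta_kept_le hD s subset_rfl (by omega)
    have hsum := Finset.sum_add_sum_compl (D.kept s) (D.β s)
    rw [hsum] at h
    have h1 : α * k ≤ ∑ x, D.β s x := by omega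
    have h1' : (α : ℝ) * k ≤ ((∑ x, D.β s x : ℕ) : ℝ) := by exact_mod_cast h1
    have e1 := mul_le_mul_of_nonneg_left h1' hr.le
    have e2 : 0 ≤ (α : ℝ) * rI * (k - r) := mul_nonneg (mul_nonneg hα hrI0) (by linarith)
    nlinarith

theorem bandwidthBound_le [Fintype F] {D : ConvertibleCode F nI k nF ς α} (hD : D.IsMDS)
    (hk : 0 < k) (hς : 2 ≤ ς) (hnI : k ≤ nI) (hnF : ς * k ≤ nF) :
    bandwidthBound (nI - k) (nF - ς * k) k ς α ≤ (D.bandwidth : ℝ) := by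
  have hnew : (((nF - ς * k : ℕ) : ℝ)) * α ≤ (D.numNew : ℝ) * α := by
    refine mul_le_mul_of_nonneg_right ?_ (by positivity)
    have := le_numNew hD hk hς hnF
    exact_mod_cast (show nF - ς * k ≤ D.numNew by omega)
  have hsum : ∀ B : ℝ, (∀ s, (α : ℝ) * B ≤ ((∑ x, D.β s x : ℕ) : ℝ)) →
      (ς : ℝ) * α * B + ((nF - ς * k : ℕ) : ℝ) * α ≤ (D.bandwidth : ℝ) := by
    intro B hB
    have h := Finset.sum_le_sum fun s (_ : s ∈ Finset.univ) => hB s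
    rw [Finset.sum_const, Finset.card_univ, Fintype.card_fin, nsmul_eq_mul, ← mul_assoc,
      ← Nat.cast_sum] at h
    unfold bandwidth
    push_cast at h ⊢
    linarith
  unfold bandwidthBound
  split_ifs with hc
  · refine hsum _ fun s => ?_
    have := mul_min_le_sum_beta hD hk hς hnF s
    exact_mod_cast this
  · push Not at hc
    exact hsum _ fun s => piggyback_bound_le_sum_beta hD hk hς (by omega) (by omega) hc.1 hc.2 s

theorem le_accessCost [Fintype F] {D : ConvertibleCode F nI k nF ς α} (hD : D.IsMDS)
    (hk : 0 < k) (hς : 2 ≤ ς) (hnF : ς * k ≤ nF) :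
    ς * min k (nF - ς * k) + (nF - ς * k) ≤ D.accessCost := by
  have h1 := le_numNew hD hk hς hnF
  have h2 : ∀ s, min k (nF - ς * k) ≤ (Finset.univ.filter fun x => D.β s x ≠ 0).card := by
    intro s
    refine Nat.le_of_mul_le_mul_left ((mul_min_le_sum_beta hD hk hς hnF s).trans ?_) hD.1.pos
    rw [← Finset.sum_filter_ne_zero, mul_comm]
    exact Finset.sum_le_card_nsmul _ _ α fun x _ => D.β_le s x
  have h3 := Finset.sum_le_sum fun s (_ : s ∈ Finset.univ) => h2 s
  rw [Finset.sum_const, Finset.card_univ, Fintype.card_fin, smul_eq_mul] at h3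
  have h4 : (Finset.univ.filter fun p : Fin ς × Fin nI => D.β p.1 p.2 ≠ 0).card =
      ∑ s, (Finset.univ.filter fun x => D.β s x ≠ 0).card := by
    simp only [Finset.card_filter, Fintype.sum_prod_type]
  unfold accessCost
  omega

theorem isAccessOptimal_of_le {D : ConvertibleCode F nI k nF ς α}
    (hk : 0 < k) (hς : 2 ≤ ς) (hnF : ς * k ≤ nF)
    (h : D.accessCost ≤ ς * min k (nF - ς * k) + (nF - ς * k)) : D.IsAccessOptimal :=
  fun _ _ _ _ _ hD' => h.trans (le_accessCost hD' hk hς hnF)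

theorem bandwidthBound_mul (rI rF k ς α : ℕ) :
    bandwidthBound rI rF k ς α = α * bandwidthBound rI rF k ς 1 := by
  unfold bandwidthBound
  split_ifs <;> push_cast <;> ring

theorem isBandwidthOptimal_of_eq {D : ConvertibleCode F nI k nF ς α}
    (hk : 0 < k) (hς : 2 ≤ ς) (hnI : k ≤ nI) (hnF : ς * k ≤ nF)
    (h : (D.bandwidth : ℝ) = bandwidthBound (nI - k) (nF - ς * k) k ς α) :
    D.IsBandwidthOptimal := by
  refine ⟨h, fun F' _ _ α' D' hD' => ?_⟩
  have h' := bandwidthBound_le hD' hk hς hnI hnF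
  rw [bandwidthBound_mul] at h h'
  have : (α' : ℝ) * D.bandwidth ≤ α * D'.bandwidth := by
    rw [h]
    calc _ = (α : ℝ) * (α' * bandwidthBound (nI - k) (nF - ς * k) k ς 1) := by ring
      _ ≤ _ := mul_le_mul_of_nonneg_left h' (by positivity)
  exact_mod_cast this

end ConvertibleCode

/-! ### Convertible codes that keep the systematic nodes -/

namespace Encoder

variable {F : Type u} [Field F] {n k ς α : ℕ}

/-- The `s`-th of the `ς` submessages of `k` symbols of a message of the final code. -/
def submessage (s : Fin ς) : (Fin (ς * k) → Fin α → F) →ₗ[F] (Fin k → Fin α → F) :=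
  LinearMap.funLeft F (Fin α → F) fun x => finProdFinEquiv (s, x)

theorem submessage_apply (s : Fin ς) (M : Fin (ς * k) → Fin α → F) (x : Fin k) :
    submessage s M x = M (finProdFinEquiv (s, x)) := rfl

theorem submessage_divNat (M : Fin (ς * k) → Fin α → F) (p : Fin (ς * k)) :
    submessage p.divNat M p.modNat = M p :=
  congrArg M (finProdFinEquiv.apply_symm_apply p)

theorem submessage_flatten (m : Fin ς → Fin k → Fin α → F) (s : Fin ς) :
    submessage s (fun p => m p.divNat p.modNat) = m s := by
  funext x
  rw [submessage_apply, divNat_finProdFinEquiv, modNat_finProdFinEquiv]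

end Encoder

namespace ConvertibleCode

open Encoder

variable {F : Type u} [Field F] {nI k r ς α : ℕ}

/-- The convertible code that keeps all the systematic nodes and computes the parities `G M` of the
final code from the subsymbols with index in `B x` of every initial node `x`.  The computation is
possible if `G M` vanishes whenever these subsymbols do. -/
noncomputable def ofReads (C : Encoder F nI k α) (hk : k ≤ nI) (hC : C.IsSystematic)
    (G : (Fin (ς * k) → Fin α → F) →ₗ[F] (Fin r → Fin α → F)) (B : Fin nI → Finset (Fin α))
    (hG : ∀ M, (∀ s x, ∀ t ∈ B x, C (submessage s M) x t = 0) → G M = 0) :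
    ConvertibleCode F nI k (ς * k + r) ς α where
  initial := C
  final := appendParity G
  origin := Fin.append (fun p : Fin (ς * k) => some (p.divNat, Fin.castLE hk p.modNat))
    (fun _ : Fin r => none)
  origin_injective y y' p := by
    refine Fin.addCases (fun z => ?_) (fun z => ?_) y <;>
      refine Fin.addCases (fun z' => ?_) (fun z' => ?_) y' <;> intro h h'
    · rw [Fin.append_left] at h h'
      have hp := h.trans h'.symm
      simp only [Option.some.injEq, Prod.mk.injEq] at hp
      have : (z.divNat, z.modNat) = (z'.divNat, z'.modNat) :=
        Prod.ext hp.1 (Fin.castLE_injective hk hp.2)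
      rw [finProdFinEquiv.symm.injective this]
    · simp at h'
    · simp at h
    · simp at h
  β _ x := (B x).card
  β_le _ x := by simpa using (B x).card_le_univ
  download _ x v i := v ((B x).equivFin.symm i)
  compute d y :=
    open Classical in
    if h : ∃ M, ∀ s x i, C (submessage s M) x ((B x).equivFin.symm i) = d s x i then
      appendParity G h.choose y else 0
  unchanged m y s x := by
    refine Fin.addCases (fun z => ?_) (fun z => ?_) y <;> intro h
    · rw [Fin.append_left] at h
      simp only [Option.some.injEq, Prod.mk.injEq] at h
      obtain ⟨rfl, rfl⟩ := h
      rw [appendParity_castAdd, hC _ _ z.modNat.isLt]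
      rfl
    · simp at h
  new m y := by
    refine Fin.addCases (fun z => ?_) (fun z => ?_) y <;> intro h
    · simp at h
    · have hex : ∃ M : Fin (ς * k) → Fin α → F, ∀ s x i,
          C (submessage s M) x ((B x).equivFin.symm i) = C (m s) x ((B x).equivFin.symm i) :=
        ⟨fun p => m p.divNat p.modNat, fun s x i => by rw [submessage_flatten]⟩
      rw [dif_pos hex, appendParity_natAdd, appendParity_natAdd]
      refine congrFun (sub_eq_zero.1 ?_) z
      rw [← map_sub]
      refine hG _ fun s x t ht => ?_
      rw [map_sub, map_sub, Pi.sub_apply, Pi.sub_apply, submessage_flatten, sub_eq_zero]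
      have := hex.choose_spec s x ((B x).equivFin ⟨t, ht⟩)
      rw [Equiv.symm_apply_apply] at this
      exact this.symm

section

variable (C : Encoder F nI k α) (hk : k ≤ nI) (hC : C.IsSystematic)
  (G : (Fin (ς * k) → Fin α → F) →ₗ[F] (Fin r → Fin α → F)) (B : Fin nI → Finset (Fin α))
  (hG : ∀ M, (∀ s x, ∀ t ∈ B x, C (submessage s M) x t = 0) → G M = 0)

theorem ofReads_origin_eq_none_iff (y : Fin (ς * k + r)) :
    (ofReads C hk hC G B hG).origin y = none ↔ ∃ z : Fin r, y = Fin.natAdd (ς * k) z := by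
  refine Fin.addCases (fun z => ?_) (fun z => ?_) y
  · refine ⟨fun h => ?_, fun ⟨z', h⟩ => ?_⟩
    · have := (Fin.append_left (n := r)
        (fun p : Fin (ς * k) => some (p.divNat, Fin.castLE hk p.modNat)) (fun _ => none)
        z).symm.trans h
      simp at this
    · have := congrArg Fin.val h
      have := z.isLt
      simp at *
      omega
  · exact ⟨fun _ => ⟨z, rfl⟩, fun _ => Fin.append_right
      (fun p : Fin (ς * k) => some (p.divNat, Fin.castLE hk p.modNat)) (fun _ => none) z⟩

theorem ofReads_numNew : (ofReads C hk hC G B hG).numNew = r := by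
  classical
  have : (Finset.univ.filter fun y => (ofReads C hk hC G B hG).origin y = none) =
      Finset.univ.map (Fin.natAddEmb (ς * k)) := by
    ext y
    simp only [Finset.mem_filter, Finset.mem_univ, true_and, ofReads_origin_eq_none_iff,
      Finset.mem_map]
    exact ⟨fun ⟨z, h⟩ => ⟨z, h.symm⟩, fun ⟨z, h⟩ => ⟨z, h.symm⟩⟩
  unfold numNew
  convert Finset.card_map (s := (Finset.univ : Finset (Fin r))) (Fin.natAddEmb (ς * k)) using 2
  · simp

theorem ofReads_bandwidth :
    (ofReads C hk hC G B hG).bandwidth = ς * ∑ x, (B x).card + r * α := by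
  rw [bandwidth, ofReads_numNew]
  simp [ofReads]

theorem ofReads_accessCost : (ofReads C hk hC G B hG).accessCost =
    ς * (Finset.univ.filter fun x => B x ≠ ∅).card + r := by
  classical
  rw [accessCost, ofReads_numNew]
  have : (Finset.univ.filter fun p : Fin ς × Fin nI => (ofReads C hk hC G B hG).β p.1 p.2 ≠ 0) =
      Finset.univ ×ˢ Finset.univ.filter fun x => B x ≠ ∅ := by
    ext p
    simp [ofReads]
  rw [this, Finset.card_product, Finset.card_univ, Fintype.card_fin]

theorem ofReads_isInstancewise (c : Fin r → Fin ς → Fin nI → F)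
    (hc : ∀ y s x, B x = ∅ → c y s x = 0)
    (h : ∀ M y t, G M y t = ∑ s, ∑ x, c y s x * C (submessage s M) x t) :
    (ofReads C hk hC G B hG).IsInstancewise := by
  refine ⟨Fin.append (0 : Fin (ς * k) → Fin ς → Fin nI → F) c, fun y s x hB => ?_,
    fun y hy m a => ?_⟩
  · refine Fin.addCases (fun z => ?_) (fun z => ?_) y
    · rw [Fin.append_left]
      rfl
    · rw [Fin.append_right]
      exact hc z s x (Finset.card_eq_zero.1 hB)
  · obtain ⟨z, rfl⟩ := (ofReads_origin_eq_none_iff C hk hC G B hG y).1 hy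
    simp only [Fin.append_right]
    refine ((congrFun (appendParity_natAdd G _ z) a).trans (h _ z a)).trans ?_
    simp only [submessage_flatten]
    rfl

end

end ConvertibleCode

/-! ### Combining parities, and the final codes of a base code -/

namespace Encoder

variable {F : Type u} [Field F] {n k ς α : ℕ}

/-- The linear map whose parity `y` is, in every instance, the combination with coefficients
`c y s a` of the first `r` parities `a` of the `ς` initial codewords. -/
def combineParity {r R : ℕ} (c : Fin r → Fin ς → Fin r → F) (hr : r ≤ R)
    (C : Encoder F (k + R) k α) : (Fin (ς * k) → Fin α → F) →ₗ[F] (Fin r → Fin α → F) where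
  toFun M y t := ∑ s, ∑ a, c y s a * C (submessage s M) (Fin.natAdd k (Fin.castLE hr a)) t
  map_add' M M' := by
    ext y t
    simp [mul_add, Finset.sum_add_distrib]
  map_smul' v M := by
    ext y t
    simp [Finset.mul_sum, mul_left_comm]

theorem combineParity_apply {r R : ℕ} (c : Fin r → Fin ς → Fin r → F) (hr : r ≤ R)
    (C : Encoder F (k + R) k α) (M : Fin (ς * k) → Fin α → F) (y : Fin r) (t : Fin α) :
    combineParity c hr C M y t =
      ∑ s, ∑ a, c y s a * C (submessage s M) (Fin.natAdd k (Fin.castLE hr a)) t := rfl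

theorem appendParity_isDecodable_of_triangular {r r' : ℕ} (rI : ℕ)
    {G : (Fin k → Fin α → F) →ₗ[F] (Fin r → Fin α → F)} (hG : (appendParity G).IsDecodable)
    {G' : (Fin k → Fin (r' * α) → F) →ₗ[F] (Fin r → Fin (r' * α) → F)}
    (h : ∀ m (j : Fin r'), ((j : ℕ) < rI ∨
        ∀ a : Fin r', (a : ℕ) < rI → instanceMessage m a = 0) →
      ∀ y t, G' m y (finProdFinEquiv (j, t)) = G (instanceMessage m j) y t) :
    (appendParity G').IsDecodable := by
  refine hG.of_triangular rI fun m j hj y t => ?_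
  refine Fin.addCases (fun x => ?_) (fun x => ?_) y
  · rw [appendParity_castAdd, appendParity_castAdd]
    rfl
  · rw [appendParity_natAdd, appendParity_natAdd, h m j hj]

theorem submessage_instanceMessage {r : ℕ} (s : Fin ς) (M : Fin (ς * k) → Fin (r * α) → F)
    (j : Fin r) : submessage s (instanceMessage M j) = instanceMessage (submessage s M) j := rfl

theorem piggybackStep_submessage_triangular {rI r : ℕ} (C : Encoder F n k α)
    (M : Fin (ς * k) → Fin (r * α) → F) (j : Fin r)
    (hj : (j : ℕ) < rI ∨ ∀ a : Fin r, (a : ℕ) < rI → instanceMessage M a = 0)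
    (s : Fin ς) (y : Fin n) (t : Fin α) :
    piggybackStep rI r C (submessage s M) y (finProdFinEquiv (j, t)) =
      C (submessage s (instanceMessage M j)) y t :=
  piggybackStep_triangular C _ j (hj.imp_right fun h a ha => by
    rw [← submessage_instanceMessage, h a ha, map_zero]) y t

theorem combineParity_piggybackStep_isDecodable {r R r' rI : ℕ} {c : Fin r → Fin ς → Fin r → F}
    {hr : r ≤ R} {C : Encoder F (k + R) k α}
    (h : (appendParity (combineParity c hr C)).IsDecodable) :
    (appendParity (combineParity c hr (C.piggybackStep rI r'))).IsDecodable := by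
  refine appendParity_isDecodable_of_triangular rI h fun M j hj y t => ?_
  simp only [combineParity_apply, piggybackStep_submessage_triangular C M j hj]

theorem combineParity_recursivePiggyback_isDecodable {r R : ℕ} {c : Fin r → Fin ς → Fin r → F}
    {hr : r ≤ R} {C : Encoder F (k + R) k 1}
    (h : (appendParity (combineParity c hr C)).IsDecodable) (rI : ℕ) :
    ∀ rs : List ℕ, (appendParity (combineParity c hr (C.recursivePiggyback rI rs))).IsDecodable
  | [] => h
  | _ :: rs => combineParity_piggybackStep_isDecodable
      (combineParity_recursivePiggyback_isDecodable h rI rs)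

/-- Final codes for fewer initial codewords are obtained by setting the other messages to zero. -/
theorem combineParity_isDecodable_of_le {ς' r R : ℕ} (hς : ς' ≤ ς) {c : Fin r → Fin ς → Fin r → F}
    {hr : r ≤ R} {C : Encoder F (k + R) k α}
    (h : (appendParity (combineParity c hr C)).IsDecodable) :
    (appendParity (combineParity (fun y (s : Fin ς') => c y (Fin.castLE hς s)) hr C)).IsDecodable
    := by
  classical
  rw [appendParity_isDecodable_iff] at h ⊢
  intro X Y hXY m hX hY
  let m' : Fin ς → Fin k → Fin α → F := fun s =>
    if hs : (s : ℕ) < ς' then submessage ⟨s, hs⟩ m else 0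
  have hm' : ∀ s : Fin ς', m' (Fin.castLE hς s) = submessage s m := fun s => dif_pos s.isLt
  have hkς : ς' * k ≤ ς * k := Nat.mul_le_mul_right k hς
  have hval : ∀ (s : Fin ς') (x : Fin k),
      Fin.castLE hkς (finProdFinEquiv (s, x)) = finProdFinEquiv (Fin.castLE hς s, x) :=
    fun s x => Fin.ext rfl
  have h0 := h (X.map (Fin.castLEEmb hkς)) Y (by simpa using hXY)
    (fun p => m' p.divNat p.modNat) (by
      intro p hp
      obtain ⟨⟨s, x⟩, rfl⟩ := finProdFinEquiv.surjective p
      rw [← submessage_apply s (fun p : Fin (ς * k) => m' p.divNat p.modNat) x, submessage_flatten]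
      by_cases hs : (s : ℕ) < ς'
      · obtain ⟨s, rfl⟩ : ∃ s' : Fin ς', Fin.castLE hς s' = s := ⟨⟨s, hs⟩, rfl⟩
        rw [hm', submessage_apply]
        refine hX _ fun hmem => hp ?_
        rw [← hval]
        exact Finset.mem_map_of_mem _ hmem
      · simp [m', hs]) (by
      intro y hy
      rw [← hY y hy]
      ext t
      simp only [combineParity_apply, submessage_flatten]
      symm
      refine Finset.sum_of_injOn (Fin.castLE hς) (Fin.castLE_injective hς).injOn (by simp)
        (fun s _ hs => ?_) (fun s _ => by rw [hm'])
      have hs' : ¬ (s : ℕ) < ς' := fun hlt => hs ⟨⟨s, hlt⟩, by simp, rfl⟩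
      simp [m', hs'])
  funext p
  rw [← submessage_divNat m, ← hm', ← submessage_flatten m', h0, map_zero]
  rfl

/-- What conversions take from the base code: the parities of its final codes are linear
combinations of the first `r` parities of the initial codewords.  They are new nodes, since a parity
of the final code involves all `ς ≥ 2` initial codewords, and a linear functional computed from the
downloaded parities is a linear combination of them. -/
theorem _root_.IsAccessOptimalBase.exists_combineParity {R : ℕ} {C : Encoder F (k + R) k 1}
    (hC : IsAccessOptimalBase ς C) (hk : 0 < k) (hς : 2 ≤ ς) {r : ℕ} (hr : r ≤ R) :
    ∃ c : Fin r → Fin ς → Fin r → F, (appendParity (combineParity c hr C)).IsDecodable := by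
  classical
  rcases r.eq_zero_or_pos with rfl | hpos
  · refine ⟨fun y => y.elim0, appendParity_isDecodable_iff.2 fun X Y hXY m hX _ => ?_⟩
    rw [Finset.eq_empty_of_isEmpty Y, Finset.card_empty, Nat.le_zero, Finset.card_eq_zero] at hXY
    subst hXY
    exact funext fun x => hX x (Finset.notMem_empty x)
  obtain ⟨D, rfl, hmds, -, hsys, hread⟩ := hC.convertible r hpos hr
  have hdec := hmds.2.isDecodable
  have hnew : ∀ (M : Fin (ς * k) → Fin 1 → F) y, D.origin y = none → D.final M y =
      D.compute (fun s x => D.download s x (D.initial (submessage s M) x)) y := by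
    intro M y hy
    have := D.new (fun s => submessage s M) y hy
    simpa only [submessage_divNat] using this
  have hkept : ∀ (M : Fin (ς * k) → Fin 1 → F) y s x, D.origin y = some (s, x) →
      D.final M y = D.initial (submessage s M) x := by
    intro M y s x hy
    have := D.unchanged (fun s => submessage s M) y s x hy
    simpa only [submessage_divNat] using this
  let L : Fin ς × Fin r → (Fin (ς * k) → Fin 1 → F) →ₗ[F] F := fun p =>
    (LinearMap.proj 0).comp ((LinearMap.proj (Fin.natAdd k (Fin.castLE hr p.2))).comp
      (D.initial.comp (submessage p.1)))
  let G : (Fin (ς * k) → Fin 1 → F) →ₗ[F] (Fin r → Fin 1 → F) :=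
    (LinearMap.funLeft F (Fin 1 → F) (Fin.natAdd (ς * k))).comp D.final
  have hG : appendParity G = D.final := hsys.eq_appendParity fun _ _ => rfl
  have horigin : ∀ y : Fin r, D.origin (Fin.natAdd (ς * k) y) = none := by
    intro y
    by_contra hne
    obtain ⟨⟨s, x⟩, hsx⟩ := Option.ne_none_iff_exists'.1 hne
    have : Nontrivial (Fin ς) := Fin.nontrivial_iff_two_le.2 hς
    obtain ⟨s', hs'⟩ := exists_ne s
    let p : Fin (ς * k) := finProdFinEquiv (s', ⟨0, hk⟩)
    have hM : (Pi.single p 1 : Fin (ς * k) → Fin 1 → F) = 0 := by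
      rw [← hG, appendParity_isDecodable_iff] at hdec
      refine hdec {p} {y} (by simp) _ (fun q hq => ?_) fun y' hy' => ?_
      · exact Pi.single_eq_of_ne (by simpa using hq) _
      · obtain rfl := Finset.mem_singleton.1 hy'
        refine (hkept _ _ s x hsx).trans ?_
        have : submessage s (Pi.single p 1 : Fin (ς * k) → Fin 1 → F) = 0 := by
          funext z
          refine Pi.single_eq_of_ne (fun h => hs' ?_) _
          exact (congrArg Prod.fst (finProdFinEquiv.injective h)).symm
        rw [this, map_zero]
        rfl
    have := congrFun (congrFun hM p) 0
    simp at this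
  have hspan : ∀ y : Fin r, ∃ c : Fin ς × Fin r → F, ∑ p, c p • L p =
      (LinearMap.proj 0).comp ((LinearMap.proj y).comp G) := by
    intro y
    rw [← Submodule.mem_span_range_iff_exists_fun]
    refine mem_span_of_iInf_ker_le_ker fun M hM => ?_
    simp only [Submodule.mem_iInf, LinearMap.mem_ker] at hM ⊢
    have h0 : D.final M (Fin.natAdd (ς * k) y) = D.final 0 (Fin.natAdd (ς * k) y) := by
      rw [hnew M _ (horigin y), hnew 0 _ (horigin y)]
      congr 1
      funext s x
      by_cases hβ : D.β s x = 0
      · funext i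
        exact absurd i.isLt (by omega)
      · obtain ⟨h1, h2⟩ := hread s x hβ
        have hx : Fin.natAdd k (Fin.castLE hr ⟨(x : ℕ) - k, by omega⟩) = x := by
          ext
          simp
          omega
        have h3 : D.initial (submessage s M) x = 0 := by
          funext t
          rw [Subsingleton.elim t 0, ← hx]
          exact hM (s, ⟨(x : ℕ) - k, by omega⟩)
        rw [h3, map_zero, map_zero]
        rfl
    rw [map_zero] at h0
    exact congrFun h0 0
  choose c hc using hspan
  refine ⟨fun y s a => c y (s, a), ?_⟩
  have : combineParity (fun y s a => c y (s, a)) hr D.initial = G := by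
    refine LinearMap.ext fun M => funext fun y => funext fun t => ?_
    have := congrArg (fun f : (Fin (ς * k) → Fin 1 → F) →ₗ[F] F => f M) (hc y)
    rw [Subsingleton.elim t 0, combineParity_apply]
    simp only [LinearMap.sum_apply, LinearMap.smul_apply, Fintype.sum_prod_type, smul_eq_mul]
      at this
    exact this
  rw [this, hG]
  exact hdec

end Encoder

/-! ### Conversion under piggybacking -/

theorem LinearMap.exists_comp_eq_of_ker_le {K V V₁ V₂ : Type*} [Field K] [AddCommGroup V]
    [Module K V] [AddCommGroup V₁] [Module K V₁] [AddCommGroup V₂] [Module K V₂] {f : V →ₗ[K] V₁}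
    {g : V →ₗ[K] V₂} (h : LinearMap.ker f ≤ LinearMap.ker g) : ∃ L : V₁ →ₗ[K] V₂, L.comp f = g := by
  obtain ⟨σ, hσ⟩ := f.rangeRestrict.exists_rightInverse_of_surjective f.range_rangeRestrict
  obtain ⟨L, hL⟩ := LinearMap.exists_extend (g.comp σ)
  refine ⟨L, LinearMap.ext fun v => ?_⟩
  have h1 : L (f v) = g (σ (f.rangeRestrict v)) :=
    congrArg (fun l => l (f.rangeRestrict v)) hL
  have h2 : f (σ (f.rangeRestrict v)) = f v :=
    congrArg Subtype.val (congrArg (fun l => l (f.rangeRestrict v)) hσ)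
  rw [LinearMap.comp_apply, h1, ← sub_eq_zero, ← map_sub]
  exact h (by rw [LinearMap.mem_ker, map_sub, h2, sub_self])

namespace Encoder

variable {F : Type u} [Field F] {n k ς α : ℕ}

/-- The systematic code `C` can be converted into a systematic code with `r` parities by reading
the subsymbols with index in `B x` of every node `x` of `ς` initial codewords. -/
def IsConvertibleReading (ς r : ℕ) (C : Encoder F n k α) (B : Fin n → Finset (Fin α)) : Prop :=
  ∃ G : (Fin (ς * k) → Fin α → F) →ₗ[F] (Fin r → Fin α → F), (appendParity G).IsDecodable ∧
    ∀ M, (∀ s x, ∀ t ∈ B x, C (submessage s M) x t = 0) → G M = 0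

/-- A piggybacking step does not destroy convertibility: the linear procedure for `C` is run on
every instance as if there were no piggybacks. These contribute only linear functions of the
messages of the instances before `rI` to the later instances of the final code, so that it is
triangular. -/
theorem IsConvertibleReading.piggybackStep {r : ℕ} {C : Encoder F n k α}
    {B : Fin n → Finset (Fin α)} (h : C.IsConvertibleReading ς r B) (rI r' : ℕ) :
    (C.piggybackStep rI r').IsConvertibleReading ς r
      fun x => Finset.univ.filter fun b => b.modNat ∈ B x := by
  classical
  obtain ⟨G, hG, hker⟩ := h
  let mask : (Fin ς → Fin n → Fin α → F) →ₗ[F] (Fin ς → Fin n → Fin α → F) :=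
    LinearMap.pi fun s => LinearMap.pi fun x => LinearMap.pi fun t =>
      if t ∈ B x then (LinearMap.proj t : (Fin α → F) →ₗ[F] F).comp
        ((LinearMap.proj x : (Fin n → Fin α → F) →ₗ[F] _).comp (LinearMap.proj s)) else 0
  have hmask : ∀ v s x t, mask v s x t = if t ∈ B x then v s x t else 0 := by
    intro v s x t
    simp only [mask, LinearMap.pi_apply]
    split_ifs <;> rfl
  let T : (Fin (ς * k) → Fin α → F) →ₗ[F] (Fin ς → Fin n → Fin α → F) :=
    mask.comp (LinearMap.pi fun s => C.comp (submessage s))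
  obtain ⟨L, hL⟩ : ∃ L : (Fin ς → Fin n → Fin α → F) →ₗ[F] (Fin r → Fin α → F), L.comp T = G := by
    refine LinearMap.exists_comp_eq_of_ker_le fun M hM => hker M fun s x t ht => ?_
    have h1 := congrFun (congrFun (congrFun (LinearMap.mem_ker.1 hM) s) x) t
    rw [LinearMap.comp_apply, hmask, if_pos ht] at h1
    exact h1
  let read (j : Fin r') : (Fin (ς * k) → Fin (r' * α) → F) →ₗ[F] (Fin ς → Fin n → Fin α → F) :=
    mask.comp (LinearMap.pi fun s => LinearMap.pi fun x =>
      (LinearMap.funLeft F F fun t => finProdFinEquiv (j, t)).comp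
        ((LinearMap.proj x).comp ((C.piggybackStep rI r').comp (submessage s))))
  have hread : ∀ j M s x t, read j M s x t = if t ∈ B x then
      C.piggybackStep rI r' (submessage s M) x (finProdFinEquiv (j, t)) else 0 :=
    fun j M s x t => hmask _ s x t
  refine ⟨LinearMap.pi fun y => LinearMap.pi fun b =>
    (LinearMap.proj b.modNat).comp ((LinearMap.proj y).comp (L.comp (read b.divNat))), ?_, ?_⟩
  · refine appendParity_isDecodable_of_triangular rI hG fun M j hj y t => ?_
    have h3 : read j M = T (instanceMessage M j) := by
      funext s x t
      rw [hread, LinearMap.comp_apply, hmask, piggybackStep_submessage_triangular C M j hj]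
      rfl
    rw [← hL]
    simp only [LinearMap.pi_apply, LinearMap.comp_apply, LinearMap.proj_apply,
      divNat_finProdFinEquiv, modNat_finProdFinEquiv, h3]
  · intro M hM
    have h0 : ∀ j, read j M = 0 := by
      intro j
      funext s x t
      rw [hread]
      split_ifs with ht
      · exact hM s x _ (by simpa [modNat_finProdFinEquiv] using ht)
      · rfl
    funext y b
    simp only [LinearMap.pi_apply, LinearMap.comp_apply, h0, map_zero]
    rfl

/-- The piggybacking step with `r` instances allows a conversion to `r` parities: the instances from
`rI` on are decoded from their systematic nodes, which reveals the piggybacks in their parities,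
that is, the parities from `rI` on of the other instances. -/
theorem isConvertibleReading_piggybackStep {r R rI : ℕ} {c : Fin r → Fin ς → Fin r → F}
    {hr : r ≤ R} {C : Encoder F (k + R) k α} (hC : C.IsSystematic)
    (h : (appendParity (combineParity c hr C)).IsDecodable) :
    (C.piggybackStep rI r).IsConvertibleReading ς r fun x =>
      if (x : ℕ) < k then Finset.univ.filter fun b => rI ≤ (b.divNat : ℕ)
      else if (x : ℕ) < k + rI then Finset.univ else ∅ := by
  let G : (Fin (ς * k) → Fin (r * α) → F) →ₗ[F] (Fin r → Fin (r * α) → F) :=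
    { toFun := fun M y b => combineParity c hr C (instanceMessage M b.divNat) y b.modNat
      map_add' := fun M M' => by
        funext y b
        exact congrFun (congrFun ((combineParity c hr C).map_add (instanceMessage M b.divNat)
          (instanceMessage M' b.divNat)) y) b.modNat
      map_smul' := fun v M => by
        funext y b
        exact congrFun (congrFun ((combineParity c hr C).map_smul v
          (instanceMessage M b.divNat)) y) b.modNat }
  refine ⟨G, appendParity_isDecodable_of_triangular 0 h fun M j _ y t => ?_, fun M hM => ?_⟩
  · change combineParity c hr C (instanceMessage M (finProdFinEquiv (j, t)).divNat) y
      (finProdFinEquiv (j, t)).modNat = _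
    rw [divNat_finProdFinEquiv, modNat_finProdFinEquiv]
  -- the instances from `rI` on are known completely
  have hlate : ∀ j : Fin r, rI ≤ (j : ℕ) → ∀ s, submessage s (instanceMessage M j) = 0 := by
    intro j hj s
    funext x t
    have hx : ((Fin.castAdd R x : Fin (k + R)) : ℕ) < k := x.isLt
    have h1 := hM s (Fin.castAdd R x) (finProdFinEquiv (j, t)) (by
      beta_reduce
      rw [if_pos hx, Finset.mem_filter, divNat_finProdFinEquiv]
      exact ⟨Finset.mem_univ _, hj⟩)
    rw [hC.piggybackStep rI r _ _ hx] at h1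
    exact h1
  have hpar : ∀ (j : Fin r) (s : Fin ς) (a : Fin r) (t : Fin α),
      C (submessage s (instanceMessage M j)) (Fin.natAdd k (Fin.castLE hr a)) t = 0 := by
    intro j s a t
    by_cases hj : rI ≤ (j : ℕ)
    · rw [hlate j hj, map_zero]
      rfl
    push Not at hj
    have hdl : ∀ (i : Fin r) (b : Fin r), (b : ℕ) < rI → C.piggybackStep rI r (submessage s M)
        (Fin.natAdd k (Fin.castLE hr b)) (finProdFinEquiv (i, t)) = 0 := by
      intro i b hb
      refine hM s _ _ ?_
      beta_reduce
      rw [if_neg (by simp), if_pos (by simpa using hb)]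
      exact Finset.mem_univ _
    by_cases ha : (a : ℕ) < rI
    · rw [← hdl j a ha]
      exact (piggybackStep_submessage_triangular C M j (.inl hj) s _ t).symm
    · have h1 := hdl a j hj
      have ha' : a.val < R := a.isLt.trans_le hr
      rw [piggybackStep_apply, dif_pos ⟨by simp, by simpa using hj, by omega, by omega⟩,
        ← submessage_instanceMessage, hlate a (by omega), map_zero, Pi.zero_apply, Pi.zero_apply,
        zero_add] at h1
      rw [← h1]
      have h2 : (⟨((Fin.natAdd k (Fin.castLE hr j) : Fin (k + R)) : ℕ) - k, by
        simp⟩ : Fin r) = j := Fin.ext (by simp)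
      rw [h2]
      rfl
  funext y b
  change combineParity c hr C (instanceMessage M b.divNat) y b.modNat = 0
  simp only [combineParity_apply, hpar, mul_zero, Finset.sum_const_zero]

theorem card_filter_modNat_mem {r : ℕ} (A : Finset (Fin α)) :
    (Finset.univ.filter fun b : Fin (r * α) => b.modNat ∈ A).card = r * A.card := by
  have : (Finset.univ.filter fun b : Fin (r * α) => b.modNat ∈ A) =
      ((Finset.univ : Finset (Fin r)) ×ˢ A).map finProdFinEquiv.toEmbedding := by
    ext b
    obtain ⟨⟨j, t⟩, rfl⟩ := finProdFinEquiv.surjective b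
    rw [Finset.mem_filter, modNat_finProdFinEquiv, Finset.mem_map_equiv, Equiv.symm_apply_apply]
    simp
  rw [this, Finset.card_map, Finset.card_product, Finset.card_univ, Fintype.card_fin]

theorem card_filter_le_divNat {r rI : ℕ} :
    (Finset.univ.filter fun b : Fin (r * α) => rI ≤ (b.divNat : ℕ)).card = (r - rI) * α := by
  have : (Finset.univ.filter fun b : Fin (r * α) => rI ≤ (b.divNat : ℕ)) =
      ((Finset.univ.filter fun j : Fin r => rI ≤ (j : ℕ)) ×ˢ Finset.univ).map
        finProdFinEquiv.toEmbedding := by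
    ext b
    obtain ⟨⟨j, t⟩, rfl⟩ := finProdFinEquiv.surjective b
    rw [Finset.mem_filter, divNat_finProdFinEquiv, Finset.mem_map_equiv, Equiv.symm_apply_apply]
    simp
  rw [this, Finset.card_map, Finset.card_product, Finset.card_univ, Fintype.card_fin]
  congr 1
  have h1 := Finset.card_filter_add_card_filter_not (s := (Finset.univ : Finset (Fin r)))
    (fun j => rI ≤ (j : ℕ))
  simp only [not_le, Fin.card_filter_val_lt, Finset.card_univ, Fintype.card_fin] at h1
  omega

/-- `C` can be converted into a code with `r` parities by reading a fraction `1 - rI / r` of every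
systematic node, namely the subsymbols in `A`, and the first `rI` parities completely. -/
def IsPiggybackConvertible {R : ℕ} (ς rI r : ℕ) (C : Encoder F (k + R) k α) : Prop :=
  ∃ A : Finset (Fin α), r * A.card = (r - rI) * α ∧ C.IsConvertibleReading ς r fun x =>
    if (x : ℕ) < k then A else if (x : ℕ) < k + rI then Finset.univ else ∅

theorem isPiggybackConvertible_piggybackStep {r R rI : ℕ} {c : Fin r → Fin ς → Fin r → F}
    {hr : r ≤ R} {C : Encoder F (k + R) k α} (hC : C.IsSystematic)
    (h : (appendParity (combineParity c hr C)).IsDecodable) :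
    (C.piggybackStep rI r).IsPiggybackConvertible ς rI r :=
  ⟨_, by rw [card_filter_le_divNat]; ring, isConvertibleReading_piggybackStep hC h⟩

theorem IsPiggybackConvertible.piggybackStep {r R rI : ℕ} {C : Encoder F (k + R) k α}
    (h : C.IsPiggybackConvertible ς rI r) (r' : ℕ) :
    (C.piggybackStep rI r').IsPiggybackConvertible ς rI r := by
  obtain ⟨A, hA, hconv⟩ := h
  refine ⟨Finset.univ.filter fun b => b.modNat ∈ A, ?_, ?_⟩
  · rw [card_filter_modNat_mem, mul_left_comm, hA]
    ring
  · convert hconv.piggybackStep rI r' using 1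
    funext x
    split_ifs <;> simp

theorem isPiggybackConvertible_recursivePiggyback {r R rI : ℕ} {c : Fin r → Fin ς → Fin r → F}
    {hr : r ≤ R} {C : Encoder F (k + R) k 1} (hC : C.IsSystematic)
    (h : (appendParity (combineParity c hr C)).IsDecodable) :
    ∀ rs : List ℕ, r ∈ rs → (C.recursivePiggyback rI rs).IsPiggybackConvertible ς rI r
  | [], hmem => absurd hmem List.not_mem_nil
  | r' :: rs, hmem => by
    by_cases heq : r = r'
    · subst heq
      exact isPiggybackConvertible_piggybackStep (hC.recursivePiggyback rI rs)
        (combineParity_recursivePiggyback_isDecodable h rI rs)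
    · exact (isPiggybackConvertible_recursivePiggyback hC h rs
        ((List.mem_cons.1 hmem).resolve_left heq)).piggybackStep r'

theorem IsConvertibleReading.puncture {n' r : ℕ} (hn : n' ≤ n) {C : Encoder F n k α}
    {B : Fin n → Finset (Fin α)} (h : C.IsConvertibleReading ς r B)
    (hB : ∀ x : Fin n, n' ≤ (x : ℕ) → B x = ∅) :
    (C.puncture hn).IsConvertibleReading ς r fun x => B (Fin.castLE hn x) := by
  obtain ⟨G, hG, hker⟩ := h
  refine ⟨G, hG, fun M hM => hker M fun s x t ht => ?_⟩
  by_cases hx : (x : ℕ) < n'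
  · exact hM s ⟨x, hx⟩ t ht
  · rw [hB x (by omega)] at ht
    exact absurd ht (Finset.notMem_empty t)

end Encoder

/-! ### Optimal conversions of the piggybacked code -/

namespace Encoder

variable {F : Type u} [Field F] {k K ς α : ℕ}

/-- The parity map that applies a scalar parity map to every subsymbol separately. -/
def instancewise {r : ℕ} (α : ℕ) (G : (Fin K → Fin 1 → F) →ₗ[F] (Fin r → Fin 1 → F)) :
    (Fin K → Fin α → F) →ₗ[F] (Fin r → Fin α → F) where
  toFun M y t := G (fun p _ => M p t) y 0
  map_add' M M' := by
    funext y t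
    exact congrFun (congrFun (G.map_add (fun p _ => M p t) (fun p _ => M' p t)) y) 0
  map_smul' v M := by
    funext y t
    exact congrFun (congrFun (G.map_smul v (fun p _ => M p t)) y) 0

theorem instancewise_isDecodable {r : ℕ} {G : (Fin K → Fin 1 → F) →ₗ[F] (Fin r → Fin 1 → F)}
    (hG : (appendParity G).IsDecodable) : (appendParity (instancewise α G)).IsDecodable := by
  rw [appendParity_isDecodable_iff] at hG ⊢
  intro X Y hXY M hX hY
  funext p t
  have h0 := hG X Y hXY (fun p _ => M p t) (fun x hx => by rw [hX x hx]; rfl) (fun y hy => by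
    funext i
    rw [Subsingleton.elim i 0]
    exact congrFun (hY y hy) t)
  exact congrFun (congrFun h0 p) 0

theorem instancewise_eq_sum {r : ℕ} (G : (Fin K → Fin 1 → F) →ₗ[F] (Fin r → Fin 1 → F))
    (M : Fin K → Fin α → F) (y : Fin r) (t : Fin α) :
    instancewise α G M y t = ∑ p, G (Pi.single p 1) y 0 * M p t := by
  let f : (Fin K → F) →ₗ[F] F := (LinearMap.proj 0 : (Fin 1 → F) →ₗ[F] F).comp
    ((LinearMap.proj y : (Fin r → Fin 1 → F) →ₗ[F] _).comp
      (G.comp (LinearMap.pi fun p => LinearMap.pi fun _ => LinearMap.proj p)))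
  refine (f.pi_apply_eq_sum_univ fun p => M p t).trans (Finset.sum_congr rfl fun p _ => ?_)
  rw [smul_eq_mul, mul_comm]
  congr 1
  refine congrFun (congrFun (congrArg G ?_) y) 0
  funext q i
  by_cases h : p = q
  · subst h
    simp [LinearMap.pi_apply]
  · simp [LinearMap.pi_apply, h]

end Encoder

namespace ConvertibleCode

open Encoder

variable {F : Type u} [Field F] {k rI r ς α : ℕ}

theorem ofReads_isMDS {nI : ℕ} {C : Encoder F nI k α} {hk : k ≤ nI} {hC : C.IsSystematic}
    {G : (Fin (ς * k) → Fin α → F) →ₗ[F] (Fin r → Fin α → F)} {B : Fin nI → Finset (Fin α)}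
    {hG : ∀ M, (∀ s x, ∀ t ∈ B x, C (submessage s M) x t = 0) → G M = 0} (hk0 : 0 < k)
    (hς : 2 ≤ ς) (hα : 0 < α) (hCdec : C.IsDecodable) (hGdec : (appendParity G).IsDecodable) :
    (ofReads C hk hC G B hG).IsMDS :=
  ⟨hCdec.isMDS hk0 hk hα, hGdec.isMDS (by positivity) (Nat.le_add_right _ _) hα⟩

/-- If the final code has at least `k` parities, then the default conversion, which reads the
systematic nodes and encodes anew, is optimal. -/
theorem exists_optimal_of_le {C : Encoder F (k + rI) k α} (hC : C.IsSystematic)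
    (hCdec : C.IsDecodable) (hk : 0 < k) (hς : 2 ≤ ς) (hα : 0 < α) (hkr : k ≤ r)
    {G : (Fin (ς * k) → Fin 1 → F) →ₗ[F] (Fin r → Fin 1 → F)}
    (hG : (appendParity G).IsDecodable) :
    ∃ D : ConvertibleCode F (k + rI) k (ς * k + r) ς α, D.initial = C ∧ D.IsMDS ∧
      D.IsBandwidthOptimal ∧ D.IsAccessOptimal ∧ D.IsInstancewise := by
  classical
  let B : Fin (k + rI) → Finset (Fin α) := Fin.append (fun _ => Finset.univ) (fun _ => ∅)
  have hB : ∀ x : Fin k, B (Fin.castAdd rI x) = Finset.univ := fun x => Fin.append_left _ _ x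
  have hB' : ∀ x : Fin rI, B (Fin.natAdd k x) = ∅ := fun x => Fin.append_right _ _ x
  have hker : ∀ M : Fin (ς * k) → Fin α → F,
      (∀ s x, ∀ t ∈ B x, C (submessage s M) x t = 0) → instancewise α G M = 0 := by
    intro M hM
    have : M = 0 := by
      funext p t
      have h := hM p.divNat (Fin.castAdd rI p.modNat) t (by rw [hB]; exact Finset.mem_univ _)
      rw [hC _ _ p.modNat.isLt] at h
      rw [← submessage_divNat M]
      exact h
    rw [this, map_zero]
  have hne : (Finset.univ : Finset (Fin α)) ≠ ∅ :=
    Finset.nonempty_iff_ne_empty.1 ⟨⟨0, hα⟩, Finset.mem_univ _⟩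
  refine ⟨ofReads C (Nat.le_add_right _ _) hC (instancewise α G) B hker, rfl,
    ofReads_isMDS hk hς hα hCdec (instancewise_isDecodable hG), ?_, ?_, ?_⟩
  · refine isBandwidthOptimal_of_eq hk hς (Nat.le_add_right _ _) (Nat.le_add_right _ _) ?_
    rw [ofReads_bandwidth, Fin.sum_univ_add]
    simp only [hB, hB', Nat.add_sub_cancel_left, bandwidthBound, hkr, or_true, if_true]
    have : min (k : ℝ) r = k := min_eq_left (by exact_mod_cast hkr)
    rw [this]
    simp
    ring
  · refine isAccessOptimal_of_le hk hς (Nat.le_add_right _ _) (le_of_eq ?_)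
    rw [ofReads_accessCost, Finset.card_filter, Fin.sum_univ_add]
    simp [hB, hB', hne, hkr]
  · refine ofReads_isInstancewise _ _ _ _ _ _
      (fun y s => Fin.append (fun x => G (Pi.single (finProdFinEquiv (s, x)) 1) y 0) 0)
      (fun y s x => ?_) fun M y t => ?_
    · refine Fin.addCases (fun x => ?_) (fun x => ?_) x
      · rw [hB]
        exact fun h => absurd h hne
      · intro _
        rw [Fin.append_right]
        rfl
    · rw [instancewise_eq_sum, ← finProdFinEquiv.sum_comp, Fintype.sum_prod_type]
      refine Finset.sum_congr rfl fun s _ => ?_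
      rw [Fin.sum_univ_add]
      simp only [Fin.append_left, Fin.append_right, Pi.zero_apply, zero_mul,
        Finset.sum_const_zero, add_zero]
      refine Finset.sum_congr rfl fun x _ => ?_
      rw [hC _ (Fin.castAdd rI x) x.isLt]
      rfl

/-- If the final code has at most as many parities as the initial one, then combining
the first `r` parities is optimal. -/
theorem exists_optimal_of_combineParity {C : Encoder F (k + rI) k α} (hC : C.IsSystematic)
    (hCdec : C.IsDecodable) (hk : 0 < k) (hς : 2 ≤ ς) (hα : 0 < α) (hr : r ≤ rI) (hrk : r ≤ k)
    {c : Fin r → Fin ς → Fin r → F} (hc : (appendParity (combineParity c hr C)).IsDecodable) :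
    ∃ D : ConvertibleCode F (k + rI) k (ς * k + r) ς α, D.initial = C ∧ D.IsMDS ∧
      D.IsBandwidthOptimal ∧ D.IsAccessOptimal ∧ D.IsInstancewise := by
  classical
  let B : Fin (k + rI) → Finset (Fin α) :=
    Fin.append (fun _ => ∅) (fun a => if (a : ℕ) < r then Finset.univ else ∅)
  have hB : ∀ x : Fin k, B (Fin.castAdd rI x) = ∅ := fun x => Fin.append_left _ _ x
  have hB' : ∀ a : Fin rI, B (Fin.natAdd k a) = if (a : ℕ) < r then Finset.univ else ∅ :=
    fun a => Fin.append_right _ _ a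
  have hker : ∀ M : Fin (ς * k) → Fin α → F,
      (∀ s x, ∀ t ∈ B x, C (submessage s M) x t = 0) → combineParity c hr C M = 0 := by
    intro M hM
    funext y t
    rw [combineParity_apply]
    refine Finset.sum_eq_zero fun s _ => Finset.sum_eq_zero fun a _ => ?_
    rw [hM s _ t (by rw [hB', if_pos (by simp)]; exact Finset.mem_univ _), mul_zero]
  have hne : (Finset.univ : Finset (Fin α)) ≠ ∅ :=
    Finset.nonempty_iff_ne_empty.1 ⟨⟨0, hα⟩, Finset.mem_univ _⟩
  have hcount : ∀ N : ℕ, (∑ a : Fin rI, if (a : ℕ) < r then N else 0) = r * N := by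
    intro N
    rw [← Finset.sum_filter, Finset.sum_const, Fin.card_filter_val_lt, min_eq_right hr,
      smul_eq_mul]
  refine ⟨ofReads C (Nat.le_add_right _ _) hC (combineParity c hr C) B hker, rfl,
    ofReads_isMDS hk hς hα hCdec hc, ?_, ?_, ?_⟩
  · refine isBandwidthOptimal_of_eq hk hς (Nat.le_add_right _ _) (Nat.le_add_right _ _) ?_
    rw [ofReads_bandwidth, Fin.sum_univ_add]
    simp only [hB, hB', Nat.add_sub_cancel_left, bandwidthBound, hr, true_or, if_true,
      apply_ite Finset.card, Finset.card_empty, Finset.card_univ, Fintype.card_fin, hcount]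
    have : min (k : ℝ) r = r := min_eq_right (by exact_mod_cast hrk)
    rw [this]
    simp
    ring
  · refine isAccessOptimal_of_le hk hς (Nat.le_add_right _ _) (le_of_eq ?_)
    rw [ofReads_accessCost, Finset.card_filter, Fin.sum_univ_add]
    have h1 : ∀ a : Fin rI, (if B (Fin.natAdd k a) ≠ ∅ then 1 else 0) =
        if (a : ℕ) < r then 1 else 0 := by
      intro a
      rw [hB']
      by_cases ha : (a : ℕ) < r <;> simp [ha, hne]
    simp only [h1, hcount, hB]
    simp [hrk]
  · refine ofReads_isInstancewise _ _ _ _ _ _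
      (fun y s => Fin.append 0 (fun a => if ha : (a : ℕ) < r then c y s ⟨a, ha⟩ else 0))
      (fun y s x => ?_) fun M y t => ?_
    · refine Fin.addCases (fun x => ?_) (fun x => ?_) x
      · intro _
        rw [Fin.append_left]
        rfl
      · rw [hB', Fin.append_right]
        intro h
        by_cases ha : (x : ℕ) < r
        · rw [if_pos ha] at h
          exact absurd h hne
        · rw [dif_neg ha]
    · rw [combineParity_apply]
      refine Finset.sum_congr rfl fun s _ => ?_
      rw [Fin.sum_univ_add]
      simp only [Fin.append_left, Fin.append_right, Pi.zero_apply, zero_mul,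
        Finset.sum_const_zero, zero_add]
      refine Finset.sum_of_injOn (Fin.castLE hr) (Fin.castLE_injective hr).injOn (by simp)
        (fun a _ ha => ?_) (fun a _ => by simp)
      rw [dif_neg fun hlt => ha ⟨⟨a, hlt⟩, by simp, rfl⟩, zero_mul]

/-- If the final code has more parities than the initial one, but fewer than `k`, then the
conversion of the piggybacking construction is optimal. -/
theorem exists_optimal_of_piggyback {C : Encoder F (k + rI) k α} (hC : C.IsSystematic)
    (hCdec : C.IsDecodable) (hk : 0 < k) (hς : 2 ≤ ς) (hα : 0 < α) (hrI : rI < r) (hrk : r < k)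
    {A : Finset (Fin α)} (hA : r * A.card = (r - rI) * α)
    (h : C.IsConvertibleReading ς r fun x =>
      if (x : ℕ) < k then A else if (x : ℕ) < k + rI then Finset.univ else ∅) :
    ∃ D : ConvertibleCode F (k + rI) k (ς * k + r) ς α, D.initial = C ∧ D.IsMDS ∧
      D.IsBandwidthOptimal := by
  classical
  obtain ⟨G, hG, hker⟩ := h
  refine ⟨ofReads C (Nat.le_add_right _ _) hC G _ hker, rfl, ofReads_isMDS hk hς hα hCdec hG, ?_⟩
  refine isBandwidthOptimal_of_eq hk hς (Nat.le_add_right _ _) (Nat.le_add_right _ _) ?_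
  rw [ofReads_bandwidth, Fin.sum_univ_add]
  have hr : (r : ℝ) ≠ 0 := by
    have : 0 < r := by omega
    positivity
  have hA' : (A.card : ℝ) = (1 - (rI : ℝ) / r) * α := by
    have h1 : (r : ℝ) * A.card = (r - rI) * α := by
      rw [← Nat.cast_sub hrI.le]
      exact_mod_cast hA
    field_simp
    linarith
  simp only [Fin.val_castAdd, Fin.is_lt, if_true, Fin.val_natAdd, add_lt_add_iff_left,
    Nat.add_sub_cancel_left, bandwidthBound, not_lt.2 (Nat.le_add_right _ _), if_false,
    Finset.sum_const, Finset.card_univ, Fintype.card_fin, smul_eq_mul]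
  rw [if_neg (by omega)]
  push_cast
  rw [hA']
  ring

end ConvertibleCode

open Encoder in
/-- The recursive piggybacking construction is bandwidth-optimal for every pair of final parameters
that it has been made for. -/
theorem IsAccessOptimalBase.exists_optimal {F : Type u} [Field F] {k rI R r ς ς' : ℕ}
    {C : Encoder F (k + R) k 1} (hC : IsAccessOptimalBase ς C) (hk : 0 < k) (hς' : 2 ≤ ς')
    (hςς' : ς' ≤ ς) (hrR : r ≤ R) (h : k + rI ≤ k + R) {rs : List ℕ} (hpos : 0 < rs.prod)
    (hmem : rI < r → r ∈ rs) :
    ∃ D : ConvertibleCode F (k + rI) k (ς' * k + r) ς' rs.prod,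
      D.initial = (C.recursivePiggyback rI rs).puncture h ∧ D.IsMDS ∧ D.IsBandwidthOptimal ∧
      (r ≤ rI → D.IsAccessOptimal ∧ D.IsInstancewise) := by
  obtain ⟨c, hc⟩ := hC.exists_combineParity hk (hς'.trans hςς') hrR
  replace hc := combineParity_isDecodable_of_le hςς' hc
  have hsys := (hC.systematic.recursivePiggyback rI rs).puncture h
  have hdec := (hC.isMDS.isDecodable.recursivePiggyback rI rs).puncture h
  by_cases hkr : k ≤ r
  · obtain ⟨D, h1, h2, h3, h4⟩ :=
      ConvertibleCode.exists_optimal_of_le hsys hdec hk hς' hpos hkr hc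
    exact ⟨D, h1, h2, h3, fun _ => h4⟩
  by_cases hr : r ≤ rI
  · obtain ⟨D, h1, h2, h3, h4⟩ := ConvertibleCode.exists_optimal_of_combineParity
      (c := fun y s => c y (Fin.castLE hςς' s)) hsys hdec hk hς' hpos hr (by omega)
      (combineParity_recursivePiggyback_isDecodable hc rI rs)
    exact ⟨D, h1, h2, h3, fun _ => h4⟩
  · obtain ⟨A, hA, hconv⟩ := isPiggybackConvertible_recursivePiggyback hC.systematic (rI := rI) hc
      rs (hmem (by omega))
    obtain ⟨D, h1, h2, h3⟩ := ConvertibleCode.exists_optimal_of_piggyback hsys hdec hk hς' hpos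
      (by omega) (by omega) hA (hconv.puncture h fun x hx => by
        rw [if_neg (by omega), if_neg (by omega)])
    exact ⟨D, h1, h2, h3, fun h => absurd h hr⟩

/-! ### Existence of base codes -/

open Polynomial in
/-- In a sufficiently large field there are `R` points in which every nonzero polynomial of degree
less than `N` has fewer zeros than nonzero coefficients.  They can be chosen one by one: by the
property of the points chosen before, those polynomials with coefficients in `I` and zeros in `J`
that have one zero too few are multiples of a single one, and it suffices that the new point is
not a zero of any of these finitely many polynomials. -/
theorem exists_finset_card_roots_lt_card_support {F : Type*} [Field F] [Fintype F] (N R : ℕ)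
    (hF : 2 ^ N * 2 ^ R * N + R < Fintype.card F) :
    ∃ T : Finset F, T.card = R ∧ ∀ f : F[X], f ≠ 0 → f.support ⊆ Finset.range N →
      ∀ J ⊆ T, (∀ x ∈ J, f.eval x = 0) → J.card < f.support.card := by
  classical
  suffices h : ∀ j ≤ R, ∃ T : Finset F, T.card = j ∧ ∀ f : F[X], f ≠ 0 →
      f.support ⊆ Finset.range N → ∀ J ⊆ T, (∀ x ∈ J, f.eval x = 0) → J.card < f.support.card from
    h R le_rfl
  intro j hj
  induction j with
  | zero =>
    refine ⟨∅, rfl, fun f hf _ J hJ _ => ?_⟩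
    rw [Finset.subset_empty.1 hJ, Finset.card_empty, Finset.card_pos, nonempty_support_iff]
    exact hf
  | succ j ih =>
    obtain ⟨T, hT, ih⟩ := ih (by omega)
    -- a polynomial with coefficients in `I` and zeros in `J`, if there is one
    have hex : ∀ p : Finset ℕ × Finset F, ∃ g : F[X], g ≠ 0 ∧ (p.1 ⊆ Finset.range N →
        g.natDegree ≤ N) ∧ ((∃ f : F[X], f ≠ 0 ∧ f.support ⊆ p.1 ∧ ∀ x ∈ p.2, f.eval x = 0) →
        g.support ⊆ p.1 ∧ ∀ x ∈ p.2, g.eval x = 0) := by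
      intro p
      by_cases h : ∃ f : F[X], f ≠ 0 ∧ f.support ⊆ p.1 ∧ ∀ x ∈ p.2, f.eval x = 0
      · obtain ⟨f, hf, hs, he⟩ := h
        refine ⟨f, hf, fun hp => ?_, fun _ => ⟨hs, he⟩⟩
        exact (Finset.mem_range.1 (hp (hs (natDegree_mem_support_of_nonzero hf)))).le
      · exact ⟨1, one_ne_zero, fun _ => by simp, fun h' => absurd h' h⟩
    choose g hg0 hgdeg hg using hex
    let bad : Finset F := (((Finset.range N).powerset ×ˢ T.powerset).biUnion fun p =>
      (g p).roots.toFinset) ∪ T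
    have hbad : bad.card < Fintype.card F := by
      refine lt_of_le_of_lt ?_ hF
      refine (Finset.card_union_le _ _).trans (Nat.add_le_add ?_ (by omega))
      refine (Finset.card_biUnion_le_card_mul _ _ N fun p hp => ?_).trans ?_
      · rw [Finset.mem_product, Finset.mem_powerset] at hp
        exact (Multiset.toFinset_card_le _).trans ((card_roots' _).trans (hgdeg p hp.1))
      · rw [Finset.card_product, Finset.card_powerset, Finset.card_powerset, Finset.card_range, hT]
        gcongr
        · norm_num
        · omega
    obtain ⟨θ, hθ⟩ : ∃ θ, θ ∉ bad := by
      by_contra! h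
      rw [Finset.eq_univ_iff_forall.2 h, Finset.card_univ] at hbad
      exact lt_irrefl _ hbad
    have hθT : θ ∉ T := fun h => hθ (Finset.mem_union_right _ h)
    refine ⟨insert θ T, by rw [Finset.card_insert_of_notMem hθT, hT], fun f hf hsupp J hJ he => ?_⟩
    by_cases hθJ : θ ∈ J
    · by_contra! hle
      have hJ' : J.erase θ ⊆ T := by
        intro x hx
        exact (Finset.mem_insert.1 (hJ (Finset.mem_of_mem_erase hx))).resolve_left
          (Finset.ne_of_mem_erase hx)
      have hlt := ih f hf hsupp _ hJ' fun x hx => he x (Finset.mem_of_mem_erase hx)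
      rw [Finset.card_erase_of_mem hθJ] at hlt
      obtain ⟨hgs, hge⟩ := hg (f.support, J.erase θ)
        ⟨f, hf, subset_rfl, fun x hx => he x (Finset.mem_of_mem_erase hx)⟩
      set G := g (f.support, J.erase θ) with hG
      obtain ⟨i, hi⟩ := nonempty_support_iff.2 (hg0 (f.support, J.erase θ))
      have hif : i ∈ f.support := hgs hi
      -- eliminating one coefficient leaves too few of them
      have hzero : C (f.coeff i) * G - C (G.coeff i) * f = 0 := by
        by_contra hne
        have hs : (C (f.coeff i) * G - C (G.coeff i) * f).support ⊆ f.support.erase i := by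
          intro l hl
          rw [mem_support_iff, coeff_sub, coeff_C_mul, coeff_C_mul] at hl
          refine Finset.mem_erase.2 ⟨?_, ?_⟩
          · rintro rfl
            exact hl (by ring)
          · by_contra hlf
            have h1 : f.coeff l = 0 := notMem_support_iff.1 hlf
            have h2 : G.coeff l = 0 := notMem_support_iff.1 fun h => hlf (hgs h)
            exact hl (by rw [h1, h2]; ring)
        have h1 := ih _ hne (hs.trans ((Finset.erase_subset _ _).trans hsupp)) _ hJ'
          fun x hx => by
            rw [eval_sub, eval_mul, eval_mul, hge x hx, he x (Finset.mem_of_mem_erase hx)]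
            ring
        have h2 := Finset.card_le_card hs
        rw [Finset.card_erase_of_mem hif] at h2
        rw [Finset.card_erase_of_mem hθJ] at h1
        omega
      have hroot : G.eval θ = 0 := by
        have h1 := congrArg (eval θ) hzero
        rw [eval_sub, eval_mul, eval_mul, he θ hθJ, eval_C, mul_zero, sub_zero, eval_zero] at h1
        exact (mul_eq_zero.1 h1).resolve_left (mem_support_iff.1 hif)
      refine hθ (Finset.mem_union_left _ (Finset.mem_biUnion.2 ⟨(f.support, J.erase θ), ?_, ?_⟩))
      · rw [Finset.mem_product, Finset.mem_powerset, Finset.mem_powerset]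
        exact ⟨hsupp, hJ'⟩
      · rw [Multiset.mem_toFinset, mem_roots (hg0 _)]
        exact hroot
    · exact ih f hf hsupp J (fun x hx => (Finset.mem_insert.1 (hJ hx)).resolve_left
        fun h => hθJ (h ▸ hx)) he

namespace Encoder

variable {F : Type u} [Field F] {k ς R r : ℕ}

/-- The parity map of a Vandermonde code: parity `y` is the value of the message, as a
polynomial, at `θ y`. -/
def vandermondeParity (k : ℕ) (θ : Fin r → F) : (Fin k → Fin 1 → F) →ₗ[F] (Fin r → Fin 1 → F) where
  toFun m y _ := ∑ x, m x 0 * θ y ^ (x : ℕ)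
  map_add' m m' := by
    ext y t
    simp [add_mul, Finset.sum_add_distrib]
  map_smul' v m := by
    ext y t
    simp [Finset.mul_sum, mul_assoc]

theorem vandermondeParity_apply (θ : Fin r → F) (m : Fin k → Fin 1 → F) (y : Fin r) (t : Fin 1) :
    vandermondeParity k θ m y t = ∑ x, m x 0 * θ y ^ (x : ℕ) := rfl

open Polynomial in
theorem vandermondeParity_isDecodable {N : ℕ} (hk : k ≤ N) {θ : Fin r → F}
    (hinj : Function.Injective θ) {T : Finset F} (hθ : ∀ y, θ y ∈ T)
    (hT : ∀ f : F[X], f ≠ 0 → f.support ⊆ Finset.range N →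
      ∀ J ⊆ T, (∀ x ∈ J, f.eval x = 0) → J.card < f.support.card) :
    (appendParity (vandermondeParity k θ)).IsDecodable := by
  classical
  refine appendParity_isDecodable_iff.2 fun X Y hXY m hX hY => ?_
  let f : F[X] := ∑ x : Fin k, C (m x 0) * Polynomial.X ^ (x : ℕ)
  have hcoeff : ∀ i, f.coeff i = if h : i < k then m ⟨i, h⟩ 0 else 0 := by
    intro i
    simp only [f, finsetSum_coeff, coeff_C_mul, coeff_X_pow]
    split_ifs with h
    · rw [Finset.sum_eq_single ⟨i, h⟩]
      · simp
      · intro x _ hx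
        rw [if_neg fun h' => hx (Fin.ext h'.symm), mul_zero]
      · simp
    · refine Finset.sum_eq_zero fun x _ => ?_
      rw [if_neg (by have := x.isLt; omega), mul_zero]
  have hsupp : f.support ⊆ X.map Fin.valEmbedding := by
    intro i hi
    rw [mem_support_iff, hcoeff] at hi
    split_ifs at hi with h
    · refine Finset.mem_map.2 ⟨⟨i, h⟩, ?_, rfl⟩
      by_contra hx
      exact hi (by rw [hX _ hx]; rfl)
    · exact absurd rfl hi
  have hf : f = 0 := by
    by_contra hne
    have h1 := hT f hne (hsupp.trans fun i hi => by
        obtain ⟨x, -, rfl⟩ := Finset.mem_map.1 hi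
        exact Finset.mem_range.2 (x.isLt.trans_le hk)) (Y.image θ)
      (fun z hz => by
        obtain ⟨y, -, rfl⟩ := Finset.mem_image.1 hz
        exact hθ y)
      (fun z hz => by
        obtain ⟨y, hy, rfl⟩ := Finset.mem_image.1 hz
        rw [← show vandermondeParity k θ m y 0 = 0 from congrFun (hY y hy) 0,
          vandermondeParity_apply]
        simp [f, eval_finsetSum])
    rw [Finset.card_image_of_injective _ hinj] at h1
    have h2 := Finset.card_le_card hsupp
    rw [Finset.card_map] at h2
    omega
  funext x t
  rw [Subsingleton.elim t 0]
  have := hcoeff x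
  rw [hf, coeff_zero, dif_pos x.isLt] at this
  exact this.symm

theorem vandermondeParity_eq_sum (θ : Fin r → F) (M : Fin (ς * k) → Fin 1 → F) (y : Fin r)
    (t : Fin 1) : vandermondeParity (ς * k) θ M y t =
      ∑ s : Fin ς, θ y ^ (k * (s : ℕ)) * vandermondeParity k θ (submessage s M) y 0 := by
  rw [vandermondeParity_apply, ← finProdFinEquiv.sum_comp, Fintype.sum_prod_type]
  refine Finset.sum_congr rfl fun s _ => ?_
  rw [vandermondeParity_apply, Finset.mul_sum]
  refine Finset.sum_congr rfl fun x _ => ?_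
  rw [submessage_apply, finProdFinEquiv_apply_val, pow_add]
  ring

/-- Vandermonde codes at points as above are base codes: a parity of the final code is the sum of
the parities at the same point of the initial codewords, multiplied by powers of this point.  If
`r ≥ k`, the first `k` parities are read; they determine the message. -/
theorem isAccessOptimalBase_vandermonde (hk : 0 < k) (hς : 2 ≤ ς) {θ : Fin R → F}
    (hθ : ∀ (K r : ℕ) (hr : r ≤ R), K ≤ ς * k →
      (appendParity (vandermondeParity K fun y : Fin r => θ (Fin.castLE hr y))).IsDecodable) :
    IsAccessOptimalBase ς (appendParity (vandermondeParity k θ)) := by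
  classical
  have hkς : k ≤ ς * k := Nat.le_mul_of_pos_left k (by omega)
  have hdec : (appendParity (vandermondeParity k θ)).IsDecodable := hθ k R le_rfl hkς
  refine ⟨appendParity_isSystematic _, hdec.isMDS hk (Nat.le_add_right _ _) one_pos,
    fun r _ hr => ?_⟩
  let B : Fin (k + R) → Finset (Fin 1) :=
    Fin.append (fun _ => ∅) (fun a => if (a : ℕ) < min k r then Finset.univ else ∅)
  have hB : ∀ x : Fin k, B (Fin.castAdd R x) = ∅ := fun x => Fin.append_left _ _ x
  have hB' : ∀ a : Fin R, B (Fin.natAdd k a) = if (a : ℕ) < min k r then Finset.univ else ∅ :=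
    fun a => Fin.append_right _ _ a
  have hker : ∀ M : Fin (ς * k) → Fin 1 → F, (∀ s x, ∀ t ∈ B x,
      appendParity (vandermondeParity k θ) (submessage s M) x t = 0) →
      vandermondeParity (ς * k) (fun y : Fin r => θ (Fin.castLE hr y)) M = 0 := by
    intro M hM
    have hread : ∀ s (a : Fin R), (a : ℕ) < min k r →
        vandermondeParity k θ (submessage s M) a = 0 := by
      intro s a ha
      funext t
      have h := hM s (Fin.natAdd k a) t (by rw [hB', if_pos ha]; exact Finset.mem_univ _)
      rwa [appendParity_natAdd] at h
    have hpar : ∀ s (y : Fin r),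
        vandermondeParity k θ (submessage s M) (Fin.castLE hr y) 0 = 0 := by
      intro s y
      by_cases hkr : k ≤ r
      · have h0 : submessage s M = 0 := by
          refine appendParity_isDecodable_iff.1 hdec Finset.univ
            (Finset.univ.filter fun a : Fin R => (a : ℕ) < k) ?_ _ (fun x hx => ?_) fun a ha => ?_
          · rw [Fin.card_filter_val_lt, min_eq_right (hkr.trans hr), Finset.card_univ,
              Fintype.card_fin]
          · exact absurd (Finset.mem_univ x) hx
          · exact hread s a (by rw [min_eq_left hkr]; exact (Finset.mem_filter.1 ha).2)
        rw [h0, map_zero]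
        rfl
      · rw [hread s _ (by rw [min_eq_right (by omega)]; exact y.isLt)]
        rfl
    funext y t
    rw [vandermondeParity_eq_sum]
    refine Finset.sum_eq_zero fun s _ => ?_
    have h1 : vandermondeParity k (fun y : Fin r => θ (Fin.castLE hr y)) (submessage s M) y 0 = 0 :=
      hpar s y
    rw [h1, mul_zero]
  refine ⟨ConvertibleCode.ofReads _ (Nat.le_add_right _ _) (appendParity_isSystematic _)
    (vandermondeParity (ς * k) fun y : Fin r => θ (Fin.castLE hr y)) B hker, rfl,
    ConvertibleCode.ofReads_isMDS hk hς one_pos hdec (hθ _ _ hr le_rfl), ?_,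
    appendParity_isSystematic _, fun s x => ?_⟩
  · refine ConvertibleCode.isAccessOptimal_of_le hk hς (Nat.le_add_right _ _) (le_of_eq ?_)
    rw [ConvertibleCode.ofReads_accessCost, Finset.card_filter, Fin.sum_univ_add]
    have h1 : ∀ a : Fin R, (if B (Fin.natAdd k a) ≠ ∅ then 1 else 0) =
        if (a : ℕ) < min k r then 1 else 0 := by
      intro a
      rw [hB']
      by_cases ha : (a : ℕ) < min k r
      · rw [if_pos ha, if_pos ha]
        simp
      · rw [if_neg ha, if_neg ha]
        simp
    simp only [h1, hB]
    rw [← Finset.card_filter (fun a : Fin R => (a : ℕ) < min k r), Fin.card_filter_val_lt]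
    have h2 : min R (min k r) = min k r := min_eq_right ((min_le_right _ _).trans hr)
    rw [h2]
    simp
  · refine Fin.addCases (fun x => ?_) (fun a => ?_) x
    · intro h
      exact absurd (by rw [hB, Finset.card_empty] : (B (Fin.castAdd R x)).card = 0) h
    · intro h
      have ha : (a : ℕ) < min k r := by
        by_contra ha
        exact h (by
          change (B (Fin.natAdd k a)).card = 0
          rw [hB', if_neg ha, Finset.card_empty])
      simp only [Fin.val_natAdd]
      omega

theorem exists_isAccessOptimalBase [Fintype F] (hk : 0 < k) (hς : 2 ≤ ς)
    (hF : 2 ^ (ς * k) * 2 ^ R * (ς * k) + R < Fintype.card F) :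
    ∃ C : Encoder F (k + R) k 1, IsAccessOptimalBase ς C := by
  obtain ⟨T, hTcard, hT⟩ := exists_finset_card_roots_lt_card_support (ς * k) R hF
  let e := T.equivFinOfCardEq hTcard
  refine ⟨_, isAccessOptimalBase_vandermonde (θ := fun y => (e.symm y : F)) hk hς
    fun K r hr hK => vandermondeParity_isDecodable hK ?_ (fun y => (e.symm _).2) hT⟩
  exact Subtype.val_injective.comp (e.symm.injective.comp (Fin.castLE_injective hr))

end Encoder

theorem mainTheorem3 (nI kI : ℕ) (hk : 1 ≤ kI) (hn : kI ≤ nI)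
    -- the finite set of final parameters `(nF, kF)`, all in the merge regime
    (S : Finset (ℕ × ℕ))
    (hS : ∀ p ∈ S, p.2 ≤ p.1 ∧ ∃ ς' : ℕ, 2 ≤ ς' ∧ p.2 = ς' * kI)
    -- the distinct values `nF - kF` that exceed `nI - kI`, in any order
    (rs : List ℕ) (hrs : rs.Nodup)
    (hmem : ∀ r, r ∈ rs ↔ nI - kI < r ∧ ∃ p ∈ S, p.1 - p.2 = r)
    -- `ς` initial codewords and `R` parities for the base code: at least what `S` asks for
    (ς R : ℕ) (hς : 2 ≤ ς) (hςS : ∀ p ∈ S, p.2 ≤ ς * kI)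
    (hR : nI ≤ kI + R) (hRS : ∀ p ∈ S, p.1 - p.2 ≤ R) :
    (∃ q : ℕ, ∀ (F : Type u) [Field F] [Fintype F], q ≤ Fintype.card F →
      ∃ C : Encoder F (kI + R) kI 1, IsAccessOptimalBase ς C) ∧
    ∀ (F : Type u) [Field F] [Fintype F] (C : Encoder F (kI + R) kI 1), IsAccessOptimalBase ς C →
      ((C.recursivePiggyback (nI - kI) rs).puncture hR).IsMDS ∧
      ∀ nF ς' : ℕ, (nF, ς' * kI) ∈ S →
        ∃ D : ConvertibleCode F nI kI nF ς' rs.prod,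
          D.initial = (C.recursivePiggyback (nI - kI) rs).puncture hR ∧
          D.IsMDS ∧ D.IsBandwidthOptimal ∧
          (nF - ς' * kI ≤ nI - kI → D.IsAccessOptimal ∧ D.IsInstancewise) := by
  refine ⟨⟨2 ^ (ς * kI) * 2 ^ R * (ς * kI) + R + 1, fun F _ _ hF =>
    Encoder.exists_isAccessOptimalBase hk hς hF⟩, fun F _ _ C hC => ?_⟩
  have hpos : 0 < rs.prod := List.prod_pos fun r hr => (Nat.zero_le _).trans_lt ((hmem r).1 hr).1
  refine ⟨((hC.isMDS.isDecodable.recursivePiggyback _ rs).puncture hR).isMDS hk hn hpos,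
    fun nF ς' hmemS => ?_⟩
  obtain ⟨hle, ς'', hς'', heq⟩ := hS _ hmemS
  obtain rfl : ς' = ς'' := Nat.eq_of_mul_eq_mul_right hk heq
  obtain ⟨r, rfl⟩ : ∃ r, nF = ς' * kI + r := ⟨nF - ς' * kI, by simp only at hle; omega⟩
  have hςς' : ς' ≤ ς := Nat.le_of_mul_le_mul_right (hςS _ hmemS) hk
  have hrR : r ≤ R := by simpa using hRS _ hmemS
  have hr : nI - kI < r → r ∈ rs := fun h => (hmem r).2 ⟨h, _, hmemS, by simp⟩
  generalize hrI : nI - kI = rI at *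
  obtain rfl : nI = kI + rI := by omega
  rw [Nat.add_sub_cancel_left]
  exact hC.exists_optimal hk hς'' hςς' hrR hR hpos hr
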